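/- Let $\mu$ be a Borel probability measure on $\mathbb{C}$ and let $\{z_{n,i}\}_{n\ge 1,\,1\le i\le n}$ be a (deterministic) $\mu$-distributed triangular array of complex numbers, i.e. $\frac1n\sum_{i=1}^n\delta_{z_{n,i}}\to\mu$ weakly as $n\to\infty$. Fix $k\in\mathbb{N}$, and for each $n\ge1$ let $(X_{n,1},\dots,X_{n,k})$ be a random vector in $\mathbb{C}^k$ with a joint probability density $\nu_n$ with respect to Lebesgue measure on $\mathbb{C}^k$. Suppose that there are constants $C_1,C_2>0$ and $a\in[0,1)$ such that, for all $n\ge1$ and $1\le i\le k$, $$\int_{\mathbb{C}^k}\sum_{j=1}^k\log_+|w_j|\;\nu_n(w_1,\dots,w_k)\,dw_1\cdots dw_k\le C_1,$$ $$\sup_{w_i\in\mathbb{C}}\nu_n(w_1,\dots,w_k)\le C_2\,e^{n^a}\int_{\mathbb{C}}\nu_n(w_1,\dots,w_k)\,dw_i\quad\text{for all } w_1,\dots,w_{i-1},w_{i+1},\dots,w_k\in\mathbb{C},$$ and that $$\lim_{r\to\infty}\limsup_{n\to\infty}\mathbf{P}\Big(\max_{1\le i\le k}|X_{n,i}|\ge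 r\Big)=0.$$ Let $$P_n(t)=(t-z_{n,1})\cdots(t-z_{n,n})(t-X_{n,1})\cdots(t-X_{n,k}).$$ For a nonconstant complex polynomial $Q$, let $\mathcal{M}(Q)$ be the uniform probability measure on the multiset of zeros of $Q$ (zeros counted with multiplicity). Then, as $n\to\infty$, $\mathcal{M}(P_n)\to\mu$ in probability, and $\mathcal{M}(P_n^{(\ell)})\to\mu$ in probability for every $1\le\ell\le k$. Here random probability measures $M_n$ on $\mathbb{C}$ converge to $\mu$ in probability if $\int f\,dM_n\to\int f\,d\mu$ in probability for every bounded continuous $f:\mathbb{C}\to\mathbb{R}$. -/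

import Mathlib

open MeasureTheory Filter Topology
open scoped ENNReal BoundedContinuousFunction

/-- The uniform probability measure on a multiset `s` of complex numbers, every point being
counted with its multiplicity: `(1 / |s|) ∑_{a ∈ s} δ_a` (the zero measure if `s` is empty). -/
noncomputable def empiricalMeasure (s : Multiset ℂ) : Measure ℂ :=
  (Multiset.card s : ℝ≥0∞)⁻¹ • (s.map fun a => Measure.dirac a).sum

/-- `M(p)`: the uniform probability measure on the multiset of complex zeros of `p`. -/
noncomputable def zeroMeasure (p : Polynomial ℂ) : Measure ℂ :=
  empiricalMeasure p.roots

/-- The triangular array `(z_{n,i})_{1 ≤ i ≤ n}` is `μ`-distributed: the measures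
`(1 / n) ∑_{i ≤ n} δ_{z_{n,i}}` converge weakly to `μ` as `n → ∞`. -/
def IsDistributedArray (μ : Measure ℂ) (z : (n : ℕ) → Fin n → ℂ) : Prop :=
  ∀ f : ℂ →ᵇ ℝ, Tendsto
    (fun n => ∫ x, f x ∂(empiricalMeasure (Finset.univ.val.map (z n)))) atTop (𝓝 (∫ x, f x ∂μ))

/-- The random measures `M n` converge to the deterministic measure `μ` in probability with
respect to weak convergence: `∫ f dM_n → ∫ f dμ` in probability for every bounded continuous
function `f`. -/
def TendstoWeaklyInProbability {Ω : Type*} [MeasurableSpace Ω] (P : Measure Ω)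
    (M : ℕ → Ω → Measure ℂ) (μ : Measure ℂ) : Prop :=
  ∀ f : ℂ →ᵇ ℝ, TendstoInMeasure P (fun n ω => ∫ x, f x ∂(M n ω)) atTop
    (fun _ => ∫ x, f x ∂μ)

/-- The monic polynomial `(t - a_1) ⋯ (t - a_n) (t - b_1) ⋯ (t - b_k)` in the variable `t`. -/
noncomputable def polyWithZeros {n k : ℕ} (a : Fin n → ℂ) (b : Fin k → ℂ) : Polynomial ℂ :=
  (∏ i, (Polynomial.X - Polynomial.C (a i))) * ∏ j, (Polynomial.X - Polynomial.C (b j))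

/-! The logarithm is, up to a factor, the fundamental solution of the Laplacian, so a compactly
supported test function `φ` is uniformly approximated by potentials `∫ G z * log ‖z - a‖` with `G`
bounded and supported in a disc `D` (`exists_log_kernel`). Summing over zeros turns the difference
of two linear statistics into the integral over `D` of `G` times `log |p / q|`, up to the leading
coefficients (`abs_sum_roots_sub_le`). With `q` the `l`-th derivative of `p = P_n`, it suffices that
`log |p / q|` has `L¹(D)` norm `o(n)` in expectation; Markov's inequality and division by `n` finish
the proof, since the `k` extra zeros are negligible among `n`.

The two signs of the logarithm behave differently. The part `log⁺ |q / p|` is `O(log n)` for every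
configuration, because `p' / p` is a sum of simple poles, each uniformly integrable on `D`
(`logRatioIntegral_derivative_le`). The leading coefficients also cost `O(log n)`.

The part `log⁺ |p / q|` needs randomness. If one random zero `x` is split off, `p = (t - x) r`, then
the derivative of order `l + 1` is `(t - x) r^(l+1) + (l + 1) r^(l)`. At fixed `z` this is affine in
`x`, and its zero in `x`, when there is one, depends only on the other zeros. The bound `C₂ exp (n ^
a)` on the conditional density of `x` makes the expected logarithmic singularity there `O(n ^ a)`.
Each order of differentiation uses up one random zero, whence `l ≤ k`
(`lintegral_logRatioIntegral_le`). -/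

/-! ### Local integrability of the Cauchy and logarithmic kernels -/

/-- The integral of `1 / ‖z‖` over the unit disc. -/
noncomputable def discInvNormIntegral : ℝ≥0∞ :=
  ∫⁻ z in Metric.ball (0 : ℂ) 1, ENNReal.ofReal ‖z‖⁻¹

theorem discInvNormIntegral_ne_top : discInvNormIntegral ≠ ⊤ := by
  -- In polar coordinates the Jacobian `r` cancels `1 / r`, leaving the area of a bounded rectangle.
  have h : discInvNormIntegral ≤
      ∫⁻ p in polarCoord.target, (Set.Ioo (0 : ℝ) 1 ×ˢ Set.Ioo (-Real.pi) Real.pi).indicator 1 p := by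
    rw [discInvNormIntegral, ← lintegral_indicator Metric.isOpen_ball.measurableSet,
      ← Complex.lintegral_comp_polarCoord_symm]
    refine setLIntegral_mono' polarCoord.open_target.measurableSet fun p hp => ?_
    obtain ⟨r, θ⟩ := p
    simp only [polarCoord_target, Set.mem_prod, Set.mem_Ioi] at hp
    obtain ⟨hr, hθ⟩ := hp
    have hn : ‖Complex.polarCoord.symm (r, θ)‖ = r := by
      rw [Complex.norm_polarCoord_symm, abs_of_pos hr]
    by_cases h1 : r < 1
    · rw [Set.indicator_of_mem (by simpa [hn, abs_of_pos hr] using h1), Set.indicator_of_mem (by simp_all), hn,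
        smul_eq_mul, ← ENNReal.ofReal_mul hr.le, mul_inv_cancel₀ hr.ne']
      simp
    · rw [Set.indicator_of_notMem (by simpa [hn, abs_of_pos hr] using h1)]
      simp
  refine (h.trans (setLIntegral_le_lintegral _ _)).trans_lt ?_ |>.ne
  rw [lintegral_indicator_one (by measurability), Measure.volume_eq_prod, Measure.prod_prod]
  simp only [Real.volume_Ioo]
  exact ENNReal.mul_lt_top ENNReal.ofReal_lt_top ENNReal.ofReal_lt_top

theorem lintegral_discInvNorm_sub (a : ℂ) :
    ∫⁻ z, (Metric.ball (0 : ℂ) 1).indicator (fun z => ENNReal.ofReal ‖z‖⁻¹) (z - a)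
      = discInvNormIntegral := by
  rw [lintegral_sub_right_eq_self
    (fun z => (Metric.ball (0 : ℂ) 1).indicator (fun z => ENNReal.ofReal ‖z‖⁻¹) z) a,
    lintegral_indicator Metric.isOpen_ball.measurableSet, discInvNormIntegral]

theorem measurable_discInvNorm :
    Measurable ((Metric.ball (0 : ℂ) 1).indicator (fun z => ENNReal.ofReal ‖z‖⁻¹)) :=
  Measurable.indicator (by fun_prop) Metric.isOpen_ball.measurableSet

theorem setLIntegral_inv_norm_sub_le (D : Set ℂ) (a : ℂ) :
    ∫⁻ z in D, ENNReal.ofReal ‖z - a‖⁻¹ ≤ discInvNormIntegral + volume D := by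
  calc ∫⁻ z in D, ENNReal.ofReal ‖z - a‖⁻¹
      ≤ ∫⁻ z in D, ((Metric.ball (0 : ℂ) 1).indicator
          (fun z => ENNReal.ofReal ‖z‖⁻¹) (z - a) + 1) := by
        refine lintegral_mono fun z => ?_
        by_cases h : z - a ∈ Metric.ball (0 : ℂ) 1
        · rw [Set.indicator_of_mem h]; exact le_self_add
        · rw [Set.indicator_of_notMem h, zero_add, ← ENNReal.ofReal_one]
          refine ENNReal.ofReal_le_ofReal (inv_le_one_of_one_le₀ ?_)
          simpa using h
    _ ≤ discInvNormIntegral + volume D := by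
        rw [lintegral_add_right _ measurable_const, setLIntegral_one]
        gcongr
        rw [← lintegral_discInvNorm_sub a]
        exact setLIntegral_le_lintegral _ _

theorem integrableOn_inv_norm_sub {D : Set ℂ} (hD : volume D ≠ ⊤) (a : ℂ) :
    IntegrableOn (fun z : ℂ => ‖z - a‖⁻¹) D := by
  refine ⟨by fun_prop, ?_⟩
  rw [hasFiniteIntegral_iff_ofReal (ae_of_all _ fun z => by positivity)]
  exact (setLIntegral_inv_norm_sub_le D a).trans_lt
    (ENNReal.add_lt_top.2 ⟨discInvNormIntegral_ne_top.lt_top, hD.lt_top⟩)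

/-- Apply `log x ≤ x - 1` to `s` and to `s⁻¹`. At `s = 0` both sides vanish by convention. -/
theorem Real.abs_log_le_add_inv {s : ℝ} (hs : 0 ≤ s) : |Real.log s| ≤ s + s⁻¹ := by
  rcases hs.eq_or_lt with rfl | hs
  · simp
  · have h1 := Real.log_le_sub_one_of_pos hs
    have h2 := Real.log_le_sub_one_of_pos (inv_pos.2 hs)
    rw [Real.log_inv] at h2
    have h3 := inv_pos.2 hs
    rw [abs_le]
    constructor <;> linarith

theorem integrableOn_log_norm_sub (R : ℝ) (a : ℂ) :
    IntegrableOn (fun z : ℂ => Real.log ‖z - a‖) (Metric.closedBall 0 R) := by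
  have h1 : IntegrableOn (fun z : ℂ => ‖z - a‖ + ‖z - a‖⁻¹) (Metric.closedBall 0 R) :=
    Integrable.add ((by fun_prop : Continuous fun z : ℂ => ‖z - a‖).continuousOn.integrableOn_compact
      (isCompact_closedBall 0 R)) (integrableOn_inv_norm_sub measure_closedBall_lt_top.ne a)
  refine Integrable.mono' h1 ?_ (ae_of_all _ fun z => ?_)
  · exact (Real.measurable_log.comp (by fun_prop)).aestronglyMeasurable
  · exact Real.abs_log_le_add_inv (norm_nonneg _)

/-! ### Test functions as logarithmic potentials -/

theorem circleMap_sub_circleMap_zero (z : ℂ) (r θ : ℝ) :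
    circleMap z r θ - circleMap 0 r θ = z := by
  simp [circleMap]

theorem Real.continuous_circleAverage {φ : ℂ → ℝ} (hφ : Continuous φ) (r : ℝ) :
    Continuous fun z => Real.circleAverage φ z r := by
  simp only [Real.circleAverage_def]
  refine Continuous.const_smul (M := ℝ) ?_ (2 * Real.pi)⁻¹
  refine intervalIntegral.continuous_parametric_intervalIntegral_of_continuous' ?_ _ _
  simp only [Function.uncurry_def, circleMap]
  fun_prop

theorem Real.circleAverage_eq_zero_of_forall {φ : ℂ → ℝ} {z : ℂ} {r : ℝ}
    (h : ∀ θ, φ (circleMap z r θ) = 0) : Real.circleAverage φ z r = 0 := by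
  simp [Real.circleAverage_def, h]

theorem Real.abs_circleAverage_le_of_forall {φ : ℂ → ℝ} {C : ℝ} (hC : ∀ z, |φ z| ≤ C) (z : ℂ)
    (r : ℝ) : |Real.circleAverage φ z r| ≤ C := by
  have h := intervalIntegral.norm_integral_le_of_norm_le_const (a := 0) (b := 2 * Real.pi)
    (f := fun θ => φ (circleMap z r θ)) (C := C) (fun θ _ => hC _)
  rw [Real.circleAverage_def, smul_eq_mul, abs_mul, abs_of_pos (by positivity)]
  rw [Real.norm_eq_abs, sub_zero, abs_of_pos Real.two_pi_pos] at h
  rw [inv_mul_le_iff₀ Real.two_pi_pos]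
  exact h.trans_eq (mul_comm _ _)

theorem exists_eq_zero_of_norm_gt {φ : ℂ → ℝ} (hc : HasCompactSupport φ) :
    ∃ R : ℝ, 0 ≤ R ∧ ∀ z, R < ‖z‖ → φ z = 0 := by
  obtain ⟨R, hR⟩ := hc.isCompact.isBounded.subset_closedBall 0
  refine ⟨max R 0, le_max_right _ _, fun z hz => ?_⟩
  by_contra h
  have := hR (subset_tsupport _ h)
  rw [mem_closedBall_zero_iff] at this
  exact absurd (this.trans (le_max_left R 0)) (not_le.2 hz)

/-- Circle averages may be moved from a test function to the logarithmic kernel. -/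
theorem integral_circleAverage_mul_log {φ : ℂ → ℝ} (hφ : Continuous φ)
    (hc : HasCompactSupport φ) (r : ℝ) (a : ℂ) :
    ∫ z, Real.circleAverage φ z r * Real.log ‖z - a‖ =
      ∫ c, φ c * Real.circleAverage (fun z => Real.log ‖z - a‖) c r := by
  obtain ⟨C, hC⟩ := hc.exists_bound_of_continuous hφ
  obtain ⟨R, hR0, hR⟩ := exists_eq_zero_of_norm_gt hc
  have hC0 : 0 ≤ C := (norm_nonneg _).trans (hC 0)
  set τ : Measure ℝ := volume.restrict (Set.Ioc 0 (2 * Real.pi)) with hτ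
  set F : ℝ × ℂ → ℝ := fun p => φ (circleMap p.2 r p.1) * Real.log ‖p.2 - a‖ with hF
  have hcm : Continuous fun p : ℝ × ℂ => circleMap p.2 r p.1 := by
    simp only [circleMap]; fun_prop
  have hFm : Measurable F := (hφ.measurable.comp hcm.measurable).mul
    (Real.measurable_log.comp (by fun_prop))
  have hFi : Integrable F (τ.prod volume) := by
    have h1 : Integrable ((Metric.closedBall (0 : ℂ) (R + |r|)).indicator
        (fun z => C * Real.log ‖z - a‖)) :=
      (integrable_indicator_iff Metric.isClosed_closedBall.measurableSet).2
        ((integrableOn_log_norm_sub _ a).const_mul C)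
    refine (h1.comp_snd τ).mono hFm.aestronglyMeasurable (ae_of_all _ fun p => ?_)
    by_cases hp : p.2 ∈ Metric.closedBall (0 : ℂ) (R + |r|)
    · rw [Set.indicator_of_mem hp, hF, norm_mul, norm_mul, Real.norm_of_nonneg hC0]
      exact mul_le_mul_of_nonneg_right (hC _) (norm_nonneg _)
    · have : φ (circleMap p.2 r p.1) = 0 := by
        apply hR
        rw [mem_closedBall_zero_iff, not_le] at hp
        have h2 : ‖p.2‖ ≤ ‖circleMap p.2 r p.1‖ + |r| := by
          have := norm_sub_le (circleMap p.2 r p.1) (circleMap 0 r p.1)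
          rwa [norm_circleMap_zero, circleMap_sub_circleMap_zero] at this
        linarith
      simp [hF, this]
  -- For each fixed angle this is a translation of the plane, so the shear preserves the product
  -- measure; it moves the circular shift from `φ` to the kernel.
  have hmp : MeasurePreserving (fun p : ℝ × ℂ => (p.1, circleMap p.2 (-r) p.1))
      (τ.prod volume) (τ.prod volume) := by
    refine MeasurePreserving.skew_product (f := id) (g := fun θ c => circleMap c (-r) θ)
      (MeasurePreserving.id τ) ?_ (ae_of_all _ fun θ => ?_)
    · have : Continuous fun p : ℝ × ℂ => circleMap p.2 (-r) p.1 := by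
        simp only [circleMap]; fun_prop
      exact this.measurable
    · simp only [circleMap]
      exact map_add_right_eq_self _ _
  have hT : ∀ p : ℝ × ℂ, F (p.1, circleMap p.2 (-r) p.1) =
      φ p.2 * Real.log ‖circleMap p.2 (-r) p.1 - a‖ := by
    intro p
    have : circleMap (circleMap p.2 (-r) p.1) r p.1 = p.2 := by simp [circleMap]
    simp only [hF, this]
  have hTi : Integrable (fun p : ℝ × ℂ => F (p.1, circleMap p.2 (-r) p.1)) (τ.prod volume) :=
    (hmp.integrable_comp hFi.aestronglyMeasurable).2 hFi
  have hL : ∫ z, Real.circleAverage φ z r * Real.log ‖z - a‖ =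
      (2 * Real.pi)⁻¹ * ∫ p, F p ∂(τ.prod volume) := by
    rw [integral_prod_symm _ hFi, ← integral_const_mul]
    congr 1 with z
    rw [Real.circleAverage_def, intervalIntegral.integral_of_le Real.two_pi_pos.le, smul_eq_mul,
      mul_assoc, ← integral_mul_const]
  have hRr : ∫ c, φ c * Real.circleAverage (fun z => Real.log ‖z - a‖) c r =
      (2 * Real.pi)⁻¹ * ∫ p, F (p.1, circleMap p.2 (-r) p.1) ∂(τ.prod volume) := by
    rw [integral_prod_symm _ hTi, ← integral_const_mul]
    congr 1 with z
    -- The shear shifts by `-r`, but the circles of radius `r` and `-r` have the same average.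
    rw [← Real.circleAverage_neg_radius, Real.circleAverage_def,
      intervalIntegral.integral_of_le Real.two_pi_pos.le, smul_eq_mul,
      mul_left_comm, ← integral_const_mul]
    exact congrArg _ (integral_congr_ae (ae_of_all _ fun θ => (hT (θ, z)).symm))
  rw [hL, hRr]
  congr 1
  rw [← integral_map hmp.measurable.aemeasurable (by rw [hmp.map_eq]; exact hFi.1), hmp.map_eq]

/-- The logarithmic potential of the uniform distribution on the circle of radius `δ` minus that on
the circle of radius `δ / 2`: a bump function. -/
noncomputable def logBump (δ : ℝ) (u : ℂ) : ℝ :=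
  (Real.log δ + Real.posLog (δ⁻¹ * ‖u‖)) -
    (Real.log (δ / 2) + Real.posLog ((δ / 2)⁻¹ * ‖u‖))

theorem continuous_logBump (δ : ℝ) : Continuous (logBump δ) := by
  unfold logBump
  fun_prop

/-- Each of the two potentials is `log (max s ‖u‖)`; sign and support are read off from this form.
-/
theorem logBump_eq {δ : ℝ} (hδ : 0 < δ) (u : ℂ) :
    logBump δ u = Real.log (max δ ‖u‖) - Real.log (max (δ / 2) ‖u‖) := by
  have h : ∀ s : ℝ, 0 < s → Real.log s + Real.posLog (s⁻¹ * ‖u‖) = Real.log (max s ‖u‖) := by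
    intro s hs
    rw [Real.posLog_eq_log_max_one (by positivity), ← Real.log_mul hs.ne' (by positivity),
      mul_max_of_nonneg _ _ hs.le, mul_one, mul_inv_cancel_left₀ hs.ne']
  rw [logBump, h δ hδ, h _ (half_pos hδ)]

theorem logBump_nonneg {δ : ℝ} (hδ : 0 < δ) (u : ℂ) : 0 ≤ logBump δ u := by
  rw [logBump_eq hδ, sub_nonneg]
  exact Real.log_le_log (by positivity) (max_le_max_right _ (by linarith))

theorem logBump_eq_zero {δ : ℝ} (hδ : 0 < δ) {u : ℂ} (hu : δ ≤ ‖u‖) : logBump δ u = 0 := by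
  rw [logBump_eq hδ, max_eq_right hu, max_eq_right (by linarith), sub_self]

theorem hasCompactSupport_logBump {δ : ℝ} (hδ : 0 < δ) : HasCompactSupport (logBump δ) := by
  refine HasCompactSupport.intro (isCompact_closedBall (0 : ℂ) δ) fun u hu => ?_
  rw [mem_closedBall_zero_iff, not_le] at hu
  exact logBump_eq_zero hδ hu.le

theorem integral_logBump_pos {δ : ℝ} (hδ : 0 < δ) : 0 < ∫ u, logBump δ u := by
  refine (continuous_logBump δ).integral_pos_of_hasCompactSupport_nonneg_nonzero
    (hasCompactSupport_logBump hδ) (logBump_nonneg hδ) (x := 0) ?_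
  rw [logBump_eq hδ, norm_zero, max_eq_left hδ.le, max_eq_left (by linarith)]
  exact (sub_pos.2 (Real.log_lt_log (by linarith) (by linarith))).ne'

/-- Every continuous compactly supported function is uniformly close to the logarithmic potential
of a bounded compactly supported function. -/
theorem exists_log_kernel {φ : ℂ → ℝ} (hφ : Continuous φ) (hc : HasCompactSupport φ) {ε : ℝ}
    (hε : 0 < ε) :
    ∃ (G : ℂ → ℝ) (C R : ℝ), Continuous G ∧ 0 ≤ C ∧ 0 ≤ R ∧ (∀ z, |G z| ≤ C) ∧
      (∀ z, R < ‖z‖ → G z = 0) ∧ ∀ a, |φ a - ∫ z, G z * Real.log ‖z - a‖| ≤ ε := by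
  obtain ⟨δ, hδ, hδφ⟩ := Metric.uniformContinuous_iff.1
    (hc.uniformContinuous_of_continuous hφ) ε hε
  obtain ⟨C, hC⟩ := hc.exists_bound_of_continuous hφ
  obtain ⟨R, hR0, hR⟩ := exists_eq_zero_of_norm_gt hc
  have hI := integral_logBump_pos hδ
  set I := ∫ u, logBump δ u with hIdef
  have hC0 : 0 ≤ C := (norm_nonneg _).trans (hC 0)
  have hz : ∀ r : ℝ, |r| ≤ δ → ∀ z : ℂ, R + δ < ‖z‖ → Real.circleAverage φ z r = 0 := by
    intro r hr z hz
    refine Real.circleAverage_eq_zero_of_forall fun θ => hR _ ?_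
    have := norm_sub_le (circleMap z r θ) (circleMap 0 r θ)
    rw [norm_circleMap_zero, circleMap_sub_circleMap_zero] at this
    linarith
  have hint : ∀ r : ℝ, |r| ≤ δ → ∀ a, Integrable fun z =>
      Real.circleAverage φ z r * Real.log ‖z - a‖ := by
    intro r hr a
    rw [← integrableOn_iff_integrable_of_support_subset (s := Metric.closedBall 0 (R + δ))]
    · refine Integrable.bdd_mul (c := C) (integrableOn_log_norm_sub _ a)
        (Real.continuous_circleAverage hφ r).aestronglyMeasurable (ae_of_all _ fun z => ?_)
      exact Real.abs_circleAverage_le_of_forall hC z r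
    · intro z hz'
      by_contra h
      rw [mem_closedBall_zero_iff, not_le] at h
      exact hz' (by simp [hz r hr z h])
  have h1 : |δ| ≤ δ := by rw [abs_of_pos hδ]
  have h2 : |δ / 2| ≤ δ := by rw [abs_of_pos (half_pos hδ)]; linarith
  -- Up to normalisation, `G` is the difference of the circle averages of `φ` at radii `δ` and `δ /
  -- 2`, a discrete Laplacian. Its potential is the convolution of `φ` with `logBump δ / I`, a
  -- probability density supported in the disc of radius `δ`.
  refine ⟨fun z => I⁻¹ * (Real.circleAverage φ z δ - Real.circleAverage φ z (δ / 2)),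
    I⁻¹ * (C + C), R + δ, ?_, by positivity, by positivity, fun z => ?_, fun z hz' => ?_,
    fun a => ?_⟩
  · exact ((Real.continuous_circleAverage hφ δ).sub
      (Real.continuous_circleAverage hφ (δ / 2))).const_mul _
  · rw [abs_mul, abs_of_pos (inv_pos.2 hI)]
    gcongr
    exact (abs_sub _ _).trans (add_le_add (Real.abs_circleAverage_le_of_forall hC z _)
      (Real.abs_circleAverage_le_of_forall hC z _))
  · beta_reduce
    rw [hz δ h1 z hz', hz _ h2 z hz', sub_self, mul_zero]
  · have hlc : ∀ r : ℝ, 0 < r → ∀ c, Real.circleAverage (fun z => Real.log ‖z - a‖) c r =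
        Real.log r + Real.posLog (r⁻¹ * ‖c - a‖) := fun r hr c =>
      circleAverage_log_norm_sub_const_eq_log_radius_add_posLog hr.ne'
    have hφi : ∀ r : ℝ, Integrable fun c => φ c * (Real.log r + Real.posLog (r⁻¹ * ‖c - a‖)) :=
      fun r => (hφ.mul (by fun_prop)).integrable_of_hasCompactSupport hc.mul_right
    have hbump : Integrable fun c => logBump δ (c - a) :=
      ((continuous_logBump δ).integrable_of_hasCompactSupport
        (hasCompactSupport_logBump hδ)).comp_sub_right a
    have hφb : Integrable fun c => φ c * logBump δ (c - a) :=
      (hφ.mul ((continuous_logBump δ).comp (by fun_prop))).integrable_of_hasCompactSupport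
        hc.mul_right
    have hIa : ∫ c, logBump δ (c - a) = I := integral_sub_right_eq_self (logBump δ) a
    have hG : ∫ z, I⁻¹ * (Real.circleAverage φ z δ - Real.circleAverage φ z (δ / 2)) *
        Real.log ‖z - a‖ = I⁻¹ * ∫ c, φ c * logBump δ (c - a) := by
      simp only [mul_assoc, sub_mul]
      rw [integral_const_mul, integral_sub (hint δ h1 a) (hint _ h2 a),
        integral_circleAverage_mul_log hφ hc, integral_circleAverage_mul_log hφ hc]
      simp only [hlc δ hδ, hlc _ (half_pos hδ)]
      rw [← integral_sub (hφi _) (hφi _)]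
      simp only [logBump, mul_sub]
    have hdiff : φ a - I⁻¹ * ∫ c, φ c * logBump δ (c - a) =
        I⁻¹ * ∫ c, (φ a - φ c) * logBump δ (c - a) := by
      simp only [sub_mul]
      rw [integral_sub (hbump.const_mul _) hφb, integral_const_mul, hIa]
      field_simp
    rw [hG, hdiff, abs_mul, abs_of_pos (inv_pos.2 hI), inv_mul_le_iff₀ hI, mul_comm, ← hIa,
      ← integral_const_mul, ← Real.norm_eq_abs]
    -- Where the bump is nonzero, `‖c - a‖ < δ`, and uniform continuity bounds the oscillation of
    -- `φ` by `ε`.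
    refine norm_integral_le_of_norm_le (hbump.const_mul ε) (ae_of_all _ fun c => ?_)
    rw [norm_mul, Real.norm_of_nonneg (logBump_nonneg hδ _)]
    rcases lt_or_ge ‖c - a‖ δ with h | h
    · refine mul_le_mul_of_nonneg_right ?_ (logBump_nonneg hδ _)
      rw [← dist_eq_norm]
      exact (hδφ (by rwa [dist_comm, dist_eq_norm])).le
    · rw [logBump_eq_zero hδ h, mul_zero, mul_zero]

/-! ### Degree, leading coefficient and roots of iterated derivatives -/

open Polynomial in
theorem Polynomial.coeff_iterate_derivative_natDegree_sub {p : ℂ[X]} {l : ℕ}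
    (hl : l ≤ p.natDegree) :
    (derivative^[l] p).coeff (p.natDegree - l) = p.natDegree.descFactorial l * p.leadingCoeff := by
  rw [coeff_iterate_derivative, Nat.sub_add_cancel hl, nsmul_eq_mul, leadingCoeff]

open Polynomial in
theorem Polynomial.natDegree_iterate_derivative_eq {p : ℂ[X]} {l : ℕ} (hp : p ≠ 0)
    (hl : l ≤ p.natDegree) : (derivative^[l] p).natDegree = p.natDegree - l := by
  refine le_antisymm (natDegree_iterate_derivative p l) (le_natDegree_of_ne_zero ?_)
  rw [coeff_iterate_derivative_natDegree_sub hl]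
  refine mul_ne_zero ?_ (leadingCoeff_ne_zero.2 hp)
  simpa [Nat.descFactorial_eq_zero_iff_lt] using hl

open Polynomial in
theorem Polynomial.iterate_derivative_ne_zero {p : ℂ[X]} {l : ℕ} (hp : p ≠ 0)
    (hl : l ≤ p.natDegree) : derivative^[l] p ≠ 0 := by
  intro h
  have := coeff_iterate_derivative_natDegree_sub hl
  rw [h, coeff_zero] at this
  refine mul_ne_zero ?_ (leadingCoeff_ne_zero.2 hp) this.symm
  simpa [Nat.descFactorial_eq_zero_iff_lt] using hl

open Polynomial in
theorem Polynomial.leadingCoeff_iterate_derivative_eq {p : ℂ[X]} {l : ℕ} (hp : p ≠ 0)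
    (hl : l ≤ p.natDegree) :
    (derivative^[l] p).leadingCoeff = p.natDegree.descFactorial l * p.leadingCoeff := by
  rw [leadingCoeff, natDegree_iterate_derivative_eq hp hl, coeff_iterate_derivative_natDegree_sub hl]

theorem Polynomial.card_roots_eq (p : Polynomial ℂ) : p.roots.card = p.natDegree :=
  ((IsAlgClosed.splits p).natDegree_eq_card_roots).symm

theorem Polynomial.ae_eval_ne_zero {p : Polynomial ℂ} (hp : p ≠ 0) (D : Set ℂ) :
    ∀ᵐ z ∂(volume.restrict D), p.eval z ≠ 0 := by
  refine ae_restrict_of_ae ?_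
  have : (p.roots.toFinset : Set ℂ).Countable := p.roots.toFinset.countable_toSet
  filter_upwards [this.ae_notMem volume] with z hz h
  exact hz (by simp [hp, h])

theorem Polynomial.log_norm_eval {p : Polynomial ℂ} {z : ℂ} (h : p.eval z ≠ 0) :
    Real.log ‖p.eval z‖ =
      Real.log ‖p.leadingCoeff‖ + (p.roots.map fun a => Real.log ‖z - a‖).sum := by
  have hp : p ≠ 0 := by rintro rfl; simp at h
  have h1 : p.eval z = p.leadingCoeff * (p.roots.map fun a => z - a).prod :=
    (IsAlgClosed.splits p).eval_eq_prod_roots z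
  have h2 : ∀ s : Multiset ℂ, (∀ a ∈ s, z - a ≠ 0) →
      Real.log ‖(s.map fun a => z - a).prod‖ = (s.map fun a => Real.log ‖z - a‖).sum := by
    intro s
    induction s using Multiset.induction_on with
    | empty => simp
    | cons a s ih =>
      intro hs
      have hs' : ∀ b ∈ s, z - b ≠ 0 := fun b hb => hs b (Multiset.mem_cons_of_mem hb)
      rw [Multiset.map_cons, Multiset.prod_cons, Multiset.map_cons, Multiset.sum_cons, norm_mul,
        Real.log_mul, ih hs']
      · exact norm_ne_zero_iff.2 (hs a (Multiset.mem_cons_self a s))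
      · rw [norm_ne_zero_iff]
        exact Multiset.prod_ne_zero (by simpa [eq_comm] using hs')
  have h3 : (p.roots.map fun a => z - a).prod ≠ 0 := fun h0 => h (by rw [h1, h0, mul_zero])
  rw [h1, norm_mul, Real.log_mul (norm_ne_zero_iff.2 (leadingCoeff_ne_zero.2 hp))
    (norm_ne_zero_iff.2 h3), h2]
  intro a ha h0
  exact h3 (Multiset.prod_eq_zero (Multiset.mem_map.2 ⟨a, ha, h0⟩))

/-! ### Integrals of `log⁺` of a quotient, and the deterministic bound for derivatives -/

/-- The integral over `D` of `log⁺ |p / q|`. -/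
noncomputable def logRatioIntegral (D : Set ℂ) (p q : Polynomial ℂ) : ℝ≥0∞ :=
  ∫⁻ z in D, ENNReal.ofReal (Real.posLog (‖p.eval z‖ / ‖q.eval z‖))

theorem Polynomial.measurable_norm_eval (p : Polynomial ℂ) : Measurable fun z : ℂ => ‖p.eval z‖ :=
  p.continuous.norm.measurable

theorem measurable_posLog_ratio (p q : Polynomial ℂ) :
    Measurable fun z : ℂ => ENNReal.ofReal (Real.posLog (‖p.eval z‖ / ‖q.eval z‖)) :=
  (Real.continuous_posLog.measurable.comp
    (p.measurable_norm_eval.div q.measurable_norm_eval)).ennreal_ofReal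

/-- `log⁺` is subadditive on products, and `p / r = (p / q) (q / r)` off the null set of zeros of
`q`. This allows telescoping through successive derivatives. -/
theorem logRatioIntegral_triangle (D : Set ℂ) {p q r : Polynomial ℂ} (hq : q ≠ 0) :
    logRatioIntegral D p r ≤ logRatioIntegral D p q + logRatioIntegral D q r := by
  unfold logRatioIntegral
  rw [← lintegral_add_left (measurable_posLog_ratio p q)]
  refine lintegral_mono_ae ?_
  filter_upwards [q.ae_eval_ne_zero hq D] with z hz
  rw [← ENNReal.ofReal_add Real.posLog_nonneg Real.posLog_nonneg]
  refine ENNReal.ofReal_le_ofReal ?_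
  rw [← div_mul_div_cancel₀ (norm_ne_zero_iff.2 hz)]
  exact Real.posLog_mul

theorem logRatioIntegral_self (D : Set ℂ) (p : Polynomial ℂ) : logRatioIntegral D p p = 0 := by
  unfold logRatioIntegral
  rw [lintegral_eq_zero_iff (measurable_posLog_ratio p p)]
  refine ae_of_all _ fun z => ?_
  by_cases h : ‖p.eval z‖ = 0 <;> simp [h]

/-- From `log (s / N) ≤ s / N - 1`. For a sum `s` of `N` terms bounded in mean, the scale `N` makes
the loss only `log N`. -/
theorem Real.posLog_le_log_add_div {s N : ℝ} (hs : 0 ≤ s) (hN : 1 ≤ N) :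
    Real.posLog s ≤ Real.log N + s / N := by
  have hN0 : 0 < N := by linarith
  rw [Real.posLog_apply]
  refine max_le (add_nonneg (Real.log_nonneg hN) (by positivity)) ?_
  rcases hs.eq_or_lt with rfl | hs
  · simpa using Real.log_nonneg hN
  · have := Real.log_le_sub_one_of_pos (div_pos hs hN0)
    rw [Real.log_div hs.ne' hN0.ne'] at this
    linarith

theorem lintegral_multiset_inv_norm_le (D : Set ℂ) (s : Multiset ℂ) :
    ∫⁻ z in D, ENNReal.ofReal (s.map fun a => ‖z - a‖⁻¹).sum ≤
      s.card * (discInvNormIntegral + volume D) := by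
  induction s using Multiset.induction_on with
  | empty => simp
  | cons a s ih =>
    have h : ∀ z : ℂ, ENNReal.ofReal ((a ::ₘ s).map fun a => ‖z - a‖⁻¹).sum =
        ENNReal.ofReal ‖z - a‖⁻¹ + ENNReal.ofReal (s.map fun a => ‖z - a‖⁻¹).sum := by
      intro z
      rw [Multiset.map_cons, Multiset.sum_cons, ENNReal.ofReal_add (by positivity)]
      refine Multiset.sum_nonneg fun x hx => ?_
      obtain ⟨b, -, rfl⟩ := Multiset.mem_map.1 hx
      positivity
    simp only [h]
    rw [lintegral_add_left (by fun_prop), Multiset.card_cons, Nat.cast_add, Nat.cast_one, add_mul,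
      one_mul, add_comm]
    exact add_le_add ih (setLIntegral_inv_norm_sub_le D a)

/-- The logarithmic derivative is a sum of at most `N` simple poles, each of integral at most
`discInvNormIntegral + volume D`; dividing by the scale `N` leaves a single such term. -/
theorem logRatioIntegral_derivative_le (D : Set ℂ) {p : Polynomial ℂ} (hp : p ≠ 0) {N : ℕ}
    (hN : 1 ≤ N) (hpN : p.natDegree ≤ N) :
    logRatioIntegral D p.derivative p ≤
      ENNReal.ofReal (Real.log N) * volume D + (discInvNormIntegral + volume D) := by
  have hN' : (1 : ℝ) ≤ N := by exact_mod_cast hN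
  have hN0 : (0 : ℝ) < N := by linarith
  calc logRatioIntegral D p.derivative p
      ≤ ∫⁻ z in D, (ENNReal.ofReal (Real.log N) + ENNReal.ofReal (N : ℝ)⁻¹ *
          ENNReal.ofReal (p.roots.map fun a => ‖z - a‖⁻¹).sum) := by
        refine lintegral_mono_ae ?_
        filter_upwards [p.ae_eval_ne_zero hp D] with z hz
        rw [← ENNReal.ofReal_mul (by positivity), ← ENNReal.ofReal_add (Real.log_nonneg hN')
          (mul_nonneg (by positivity) (Multiset.sum_nonneg fun x hx => by
            obtain ⟨b, -, rfl⟩ := Multiset.mem_map.1 hx; positivity))]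
        refine ENNReal.ofReal_le_ofReal ?_
        rw [← norm_div, (IsAlgClosed.splits p).eval_derivative_div_eval_of_ne_zero hz]
        refine (Real.posLog_le_log_add_div (norm_nonneg _) hN').trans ?_
        rw [div_eq_inv_mul]
        gcongr
        refine (norm_multiset_sum_le _).trans_eq ?_
        simp
    _ = ENNReal.ofReal (Real.log N) * volume D + ENNReal.ofReal (N : ℝ)⁻¹ *
          ∫⁻ z in D, ENNReal.ofReal (p.roots.map fun a => ‖z - a‖⁻¹).sum := by
        rw [lintegral_add_left measurable_const, setLIntegral_const,
          lintegral_const_mul' _ _ ENNReal.ofReal_ne_top]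
    _ ≤ ENNReal.ofReal (Real.log N) * volume D + ENNReal.ofReal (N : ℝ)⁻¹ *
          (N * (discInvNormIntegral + volume D)) := by
        gcongr
        refine (lintegral_multiset_inv_norm_le D p.roots).trans ?_
        gcongr
        rw [p.card_roots_eq]
        exact hpN
    _ = _ := by
        rw [← mul_assoc, ← ENNReal.ofReal_natCast N, ← ENNReal.ofReal_mul (by positivity),
          inv_mul_cancel₀ hN0.ne', ENNReal.ofReal_one, one_mul]

open Polynomial in
theorem logRatioIntegral_iterate_derivative_le (D : Set ℂ) {p : ℂ[X]} (hp : p ≠ 0) {N : ℕ}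
    (hN : 1 ≤ N) (hpN : p.natDegree ≤ N) {l : ℕ} (hl : l ≤ p.natDegree) :
    logRatioIntegral D (derivative^[l] p) p ≤
      l * (ENNReal.ofReal (Real.log N) * volume D + (discInvNormIntegral + volume D)) := by
  induction l with
  | zero => simp [logRatioIntegral_self]
  | succ l ih =>
    have hl' : l ≤ p.natDegree := by lia
    have h0 := iterate_derivative_ne_zero hp hl'
    rw [Function.iterate_succ_apply', Nat.cast_add, Nat.cast_one, add_mul, one_mul, add_comm]
    refine (logRatioIntegral_triangle D h0).trans (add_le_add ?_ (ih hl'))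
    exact logRatioIntegral_derivative_le D h0 hN (by
      rw [natDegree_iterate_derivative_eq hp hl']; lia)

/-! ### Comparing the zeros of two polynomials -/

/-- The kernel approximation is summed over the points. Integrability is carried along because
splitting the integral in the inductive step requires it. -/
theorem multiset_log_potential {φ G : ℂ → ℝ} {C R ε : ℝ} (hG : Continuous G)
    (hGC : ∀ z, |G z| ≤ C)
    (h : ∀ a, |φ a - ∫ z in Metric.closedBall 0 R, G z * Real.log ‖z - a‖| ≤ ε)
    (s : Multiset ℂ) :
    IntegrableOn (fun z => G z * (s.map fun a => Real.log ‖z - a‖).sum) (Metric.closedBall 0 R) ∧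
    |(s.map φ).sum - ∫ z in Metric.closedBall 0 R, G z * (s.map fun a => Real.log ‖z - a‖).sum| ≤
      s.card * ε := by
  induction s using Multiset.induction_on with
  | empty => simp
  | cons a s ih =>
    have ha : IntegrableOn (fun z => G z * Real.log ‖z - a‖) (Metric.closedBall 0 R) :=
      Integrable.bdd_mul (c := C) (integrableOn_log_norm_sub R a) hG.aestronglyMeasurable
        (ae_of_all _ hGC)
    simp only [Multiset.map_cons, Multiset.sum_cons, mul_add, Multiset.card_cons]
    refine ⟨ha.add ih.1, ?_⟩
    rw [integral_add ha ih.1, add_sub_add_comm]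
    refine (abs_add_le _ _).trans ?_
    push_cast
    linarith [h a, ih.2]

theorem Real.abs_log_sub_log_eq {s t : ℝ} (hs : 0 < s) (ht : 0 < t) :
    |Real.log s - Real.log t| = Real.posLog (s / t) + Real.posLog (t / s) := by
  rw [← Real.log_div hs.ne' ht.ne', ← inv_div s t, Real.posLog_apply, Real.posLog_apply,
    Real.log_inv]
  rcases le_total 0 (Real.log (s / t)) with h | h
  · rw [max_eq_right h, max_eq_left (by linarith), abs_of_nonneg h, add_zero]
  · rw [max_eq_left h, max_eq_right (by linarith), abs_of_nonpos h, zero_add]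

/-- Comparison of the zeros of two polynomials by means of the logarithm of their quotient. -/
theorem abs_sum_roots_sub_le {φ G : ℂ → ℝ} {C R ε : ℝ} (hG : Continuous G) (hC : 0 ≤ C)
    (hGC : ∀ z, |G z| ≤ C)
    (h : ∀ a, |φ a - ∫ z in Metric.closedBall 0 R, G z * Real.log ‖z - a‖| ≤ ε)
    {p q : Polynomial ℂ} (hp : p ≠ 0) (hq : q ≠ 0) :
    ENNReal.ofReal |(p.roots.map φ).sum - (q.roots.map φ).sum| ≤
      ENNReal.ofReal ((p.roots.card + q.roots.card) * ε) + ENNReal.ofReal C *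
        (logRatioIntegral (Metric.closedBall 0 R) p q + logRatioIntegral (Metric.closedBall 0 R) q p
          + ENNReal.ofReal |Real.log ‖p.leadingCoeff‖ - Real.log ‖q.leadingCoeff‖| *
            volume (Metric.closedBall (0 : ℂ) R)) := by
  set D := Metric.closedBall (0 : ℂ) R
  obtain ⟨hpi, hpe⟩ := multiset_log_potential hG hGC h p.roots
  obtain ⟨hqi, hqe⟩ := multiset_log_potential hG hGC h q.roots
  set Sp : ℂ → ℝ := fun z => (p.roots.map fun a => Real.log ‖z - a‖).sum
  set Sq : ℂ → ℝ := fun z => (q.roots.map fun a => Real.log ‖z - a‖).sum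
  set L := |Real.log ‖p.leadingCoeff‖ - Real.log ‖q.leadingCoeff‖| with hL
  have h1 : |(p.roots.map φ).sum - (q.roots.map φ).sum| ≤
      (p.roots.card + q.roots.card) * ε + |∫ z in D, (G z * Sp z - G z * Sq z)| := by
    rw [integral_sub hpi hqi]
    have := abs_sub_abs_le_abs_sub ((p.roots.map φ).sum - (q.roots.map φ).sum)
      ((∫ z in D, G z * Sp z) - ∫ z in D, G z * Sq z)
    rw [sub_sub_sub_comm] at this
    have h3 := abs_sub ((p.roots.map φ).sum - ∫ z in D, G z * Sp z)
      ((q.roots.map φ).sum - ∫ z in D, G z * Sq z)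
    linarith
  have h2 : ENNReal.ofReal |∫ z in D, (G z * Sp z - G z * Sq z)| ≤ ENNReal.ofReal C *
        (logRatioIntegral D p q + logRatioIntegral D q p + ENNReal.ofReal L * volume D) := by
    rw [← Real.enorm_eq_ofReal_abs]
    refine (enorm_integral_le_lintegral_enorm _).trans ?_
    have : logRatioIntegral D p q + logRatioIntegral D q p + ENNReal.ofReal L * volume D =
        ∫⁻ z in D, (ENNReal.ofReal (Real.posLog (‖p.eval z‖ / ‖q.eval z‖)) +
          ENNReal.ofReal (Real.posLog (‖q.eval z‖ / ‖p.eval z‖)) + ENNReal.ofReal L) := by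
      rw [lintegral_add_right _ measurable_const, setLIntegral_const,
        lintegral_add_left (measurable_posLog_ratio p q)]
      rfl
    rw [this, ← lintegral_const_mul' _ _ ENNReal.ofReal_ne_top]
    refine lintegral_mono_ae ?_
    -- Off the zeros, `Sp z - Sq z` is `log |p / q|` minus the logarithm of the quotient of the
    -- leading coefficients; `L` pays for the latter.
    filter_upwards [p.ae_eval_ne_zero hp D, q.ae_eval_ne_zero hq D] with z hpz hqz
    rw [← ENNReal.ofReal_add Real.posLog_nonneg Real.posLog_nonneg,
      ← ENNReal.ofReal_add (add_nonneg Real.posLog_nonneg Real.posLog_nonneg) (abs_nonneg _),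
      ← ENNReal.ofReal_mul hC, Real.enorm_eq_ofReal_abs, ← mul_sub, abs_mul,
      ← Real.abs_log_sub_log_eq (norm_pos_iff.2 hpz) (norm_pos_iff.2 hqz),
      Polynomial.log_norm_eval hpz, Polynomial.log_norm_eval hqz]
    refine ENNReal.ofReal_le_ofReal (mul_le_mul (hGC z) ?_ (abs_nonneg _) hC)
    rw [add_sub_add_comm, add_comm |_| L]
    have := abs_sub_abs_le_abs_sub (Sp z - Sq z)
      (-(Real.log ‖p.leadingCoeff‖ - Real.log ‖q.leadingCoeff‖))
    rw [abs_neg, sub_neg_eq_add, add_comm (Sp z - Sq z)] at this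
    linarith
  refine (ENNReal.ofReal_le_ofReal h1).trans (ENNReal.ofReal_add_le.trans ?_)
  gcongr

/-! ### Logarithmic singularities under a conditional density bound -/

/-- Write `‖x‖⁻¹ = B * (B⁻¹ * ‖x‖⁻¹)` and use `log⁺ s ≤ s` on the second factor. The factor `B⁻¹`
later cancels the density bound `B`, so only `log⁺ B` survives. -/
theorem Real.ofReal_posLog_inv_norm_le {B : ℝ} (hB : 0 < B) (x : ℂ) :
    ENNReal.ofReal (Real.posLog ‖x‖⁻¹) ≤ ENNReal.ofReal (Real.posLog B) + ENNReal.ofReal B⁻¹ *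
      (Metric.ball (0 : ℂ) 1).indicator (fun z => ENNReal.ofReal ‖z‖⁻¹) x := by
  by_cases hx : x ∈ Metric.ball (0 : ℂ) 1
  · rw [Set.indicator_of_mem hx, ← ENNReal.ofReal_mul (by positivity),
      ← ENNReal.ofReal_add Real.posLog_nonneg (by positivity)]
    refine ENNReal.ofReal_le_ofReal ?_
    have h1 := Real.posLog_mul (x := B) (y := B⁻¹ * ‖x‖⁻¹)
    rw [mul_inv_cancel_left₀ hB.ne'] at h1
    have h2 := Real.posLog_le_log_add_div (s := B⁻¹ * ‖x‖⁻¹) (by positivity) le_rfl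
    rw [Real.log_one, zero_add, div_one] at h2
    linarith
  · rw [Set.indicator_of_notMem hx, mul_zero, add_zero]
    have : Real.posLog ‖x‖⁻¹ = 0 := by
      rw [Real.posLog_eq_zero_iff, abs_of_nonneg (by positivity)]
      exact inv_le_one_of_one_le₀ (by simpa using hx)
    rw [this]
    simp

/-- A bounded conditional density of the `i`-th coordinate controls the singularity of the
logarithm at any point that does not depend on this coordinate. -/
theorem lintegral_posLog_inv_norm_sub_le {k : ℕ} {ν : (Fin k → ℂ) → ℝ≥0∞} (hν : Measurable ν)
    (hν1 : ∫⁻ w, ν w = 1) {B : ℝ} (hB : 0 < B) {i : Fin k}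
    (hcond : ∀ w : Fin k → ℂ, (⨆ v : ℂ, ν (Function.update w i v)) ≤
        ENNReal.ofReal B * ∫⁻ v : ℂ, ν (Function.update w i v))
    {g : (Fin k → ℂ) → ℂ} (hg : Measurable g) (hgi : ∀ w v, g (Function.update w i v) = g w) :
    ∫⁻ w, ENNReal.ofReal (Real.posLog ‖w i - g w‖⁻¹) * ν w ≤
      ENNReal.ofReal (Real.posLog B) + discInvNormIntegral := by
  set ψ : ℂ → ℝ≥0∞ := (Metric.ball (0 : ℂ) 1).indicator (fun z => ENNReal.ofReal ‖z‖⁻¹) with hψ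
  have hψm : Measurable ψ := measurable_discInvNorm
  have hm : Measurable fun w : Fin k → ℂ => ψ (w i - g w) * ν w :=
    (hψm.comp ((measurable_pi_apply i).sub hg)).mul hν
  -- Integrate over coordinate `i` first. On a fibre `g` is constant and the density is at most `B`
  -- times the fibre mass, so the inner integral is at most `B * discInvNormIntegral` times that
  -- mass.
  have key : ∫⁻ w, ψ (w i - g w) * ν w ≤ ENNReal.ofReal B * discInvNormIntegral := by
    calc ∫⁻ w, ψ (w i - g w) * ν w
        ≤ ∫⁻ w, ENNReal.ofReal B * discInvNormIntegral * ν w := by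
          refine lintegral_le_of_lmarginal_le (μ := fun _ => volume) {i} hm (hν.const_mul _) ?_
          rw [lmarginal_singleton, lmarginal_singleton]
          intro w
          beta_reduce
          simp only [Function.update_self, hgi]
          have hνu : Measurable fun v => ν (Function.update w i v) := hν.comp (measurable_update w)
          rw [lintegral_const_mul _ hνu, mul_right_comm]
          calc ∫⁻ v, ψ (v - g w) * ν (Function.update w i v)
              ≤ ∫⁻ v, ψ (v - g w) * (ENNReal.ofReal B * ∫⁻ v, ν (Function.update w i v)) := by
                gcongr with v
                exact (le_iSup (fun v => ν (Function.update w i v)) v).trans (hcond w)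
            _ = ENNReal.ofReal B * (∫⁻ v, ν (Function.update w i v)) * discInvNormIntegral := by
                have hψg : Measurable fun v => ψ (v - g w) := hψm.comp (measurable_id.sub_const _)
                rw [lintegral_mul_const _ hψg, mul_comm]
                congr 1
                exact lintegral_discInvNorm_sub (g w)
      _ = ENNReal.ofReal B * discInvNormIntegral := by
          rw [lintegral_const_mul _ hν, hν1, mul_one]
  calc ∫⁻ w, ENNReal.ofReal (Real.posLog ‖w i - g w‖⁻¹) * ν w
      ≤ ∫⁻ w, (ENNReal.ofReal (Real.posLog B) * ν w +
          ENNReal.ofReal B⁻¹ * (ψ (w i - g w) * ν w)) := by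
        refine lintegral_mono fun w => ?_
        rw [← mul_assoc, ← add_mul]
        gcongr
        exact Real.ofReal_posLog_inv_norm_le hB _
    _ = ENNReal.ofReal (Real.posLog B) + ENNReal.ofReal B⁻¹ * ∫⁻ w, ψ (w i - g w) * ν w := by
        rw [lintegral_add_left (hν.const_mul _), lintegral_const_mul _ hν, hν1, mul_one,
          lintegral_const_mul _ hm]
    _ ≤ ENNReal.ofReal (Real.posLog B) +
          ENNReal.ofReal B⁻¹ * (ENNReal.ofReal B * discInvNormIntegral) := by gcongr
    _ = _ := by
        rw [← mul_assoc, ← ENNReal.ofReal_mul (by positivity), inv_mul_cancel₀ hB.ne',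
          ENNReal.ofReal_one, one_mul]

/-! ### Splitting off one zero -/

/-- With `y = u + (l + 1) (a / b)` the quotient is `u (a / b) / y`, and `‖a / b‖ ≤ ‖y‖ + ‖u‖`, so
its norm is at most `‖u‖ + ‖u‖² / ‖y‖`. Then `log⁺` of the sum gives `log 2` and `1 + 2` copies of
`log⁺ ‖u‖`. Apart from `u`, only the distance to the singular point enters. -/
theorem posLog_norm_moebius_le (u a b : ℂ) (l : ℕ) :
    Real.posLog ‖u * a / (u * b + (l + 1) * a)‖ ≤
      Real.log 2 + 3 * Real.posLog ‖u‖ + Real.posLog ‖u + (l + 1) * (a / b)‖⁻¹ := by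
  have hl : (1 : ℝ) ≤ ‖(l + 1 : ℂ)‖ := by
    have : (l + 1 : ℂ) = ((l + 1 : ℕ) : ℂ) := by push_cast; rfl
    rw [this, Complex.norm_natCast]
    exact_mod_cast Nat.succ_pos l
  have hl0 : (l + 1 : ℂ) ≠ 0 := norm_pos_iff.1 (by linarith)
  have hlog : 0 < Real.log 2 := Real.log_pos one_lt_two
  have hu := Real.posLog_nonneg (x := ‖u‖)
  have hr := Real.posLog_nonneg (x := ‖u + (l + 1) * (a / b)‖⁻¹)
  -- In the degenerate cases `a = 0` and `y = 0` the quotient is zero, the latter by the convention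
  -- for division; for `b = 0` it is `u / (l + 1)`.
  by_cases ha : a = 0
  · simp only [ha, mul_zero, zero_div, norm_zero, Real.posLog_zero] at hr ⊢
    linarith
  by_cases hb : b = 0
  · have h1 : Real.posLog ‖u * a / (u * b + (l + 1) * a)‖ ≤ Real.posLog ‖u‖ := by
      refine Real.posLog_le_posLog (norm_nonneg _) ?_
      rw [hb, mul_zero, zero_add, mul_div_mul_right _ _ ha, norm_div]
      exact div_le_self (norm_nonneg _) hl
    linarith
  set y := u + (l + 1) * (a / b) with hy
  have hden : u * b + (l + 1) * a = b * y := by rw [hy]; field_simp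
  by_cases hy0 : y = 0
  · rw [hden, hy0, mul_zero, div_zero, norm_zero, Real.posLog_zero]
    rw [hy0] at hr
    simp only [norm_zero] at hr ⊢
    linarith
  have hyn : 0 < ‖y‖ := norm_pos_iff.2 hy0
  have h1 : ‖u * a / (u * b + (l + 1) * a)‖ ≤ ‖u‖ + ‖u‖ ^ 2 * ‖y‖⁻¹ := by
    have h2 : ‖a / b‖ ≤ ‖y‖ + ‖u‖ := by
      have h3 : ‖(l + 1 : ℂ) * (a / b)‖ ≤ ‖y‖ + ‖u‖ := by
        have := norm_sub_le y u
        rwa [hy, add_sub_cancel_left] at this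
      rw [norm_mul] at h3
      exact (le_mul_of_one_le_left (norm_nonneg _) hl).trans h3
    have h4 : u * a / (u * b + (l + 1) * a) = u * (a / b) / y := by
      rw [hden]; field_simp
    rw [h4, norm_div, norm_mul, div_eq_mul_inv]
    calc ‖u‖ * ‖a / b‖ * ‖y‖⁻¹ ≤ ‖u‖ * (‖y‖ + ‖u‖) * ‖y‖⁻¹ := by gcongr
      _ = ‖u‖ + ‖u‖ ^ 2 * ‖y‖⁻¹ := by field_simp
  have h5 := (Real.posLog_le_posLog (norm_nonneg _) h1).trans Real.posLog_add
  have h6 := Real.posLog_mul (x := ‖u‖ ^ 2) (y := ‖y‖⁻¹)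
  rw [Real.posLog_pow] at h6
  push_cast at h6
  linarith

-- Leibniz's rule has only two terms, since a linear factor has no second derivative.
open Polynomial in
theorem Polynomial.iterate_derivative_X_sub_C_mul (x : ℂ) (p : ℂ[X]) (l : ℕ) :
    derivative^[l + 1] ((X - C x) * p) =
      (X - C x) * derivative^[l + 1] p + ((l : ℂ[X]) + 1) * derivative^[l] p := by
  induction l with
  | zero => simp [derivative_mul, add_comm]
  | succ l ih =>
    rw [Function.iterate_succ_apply', ih, derivative_add, derivative_mul, derivative_mul,
      ← Function.iterate_succ_apply' derivative, ← Function.iterate_succ_apply' derivative]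
    simp only [derivative_sub, derivative_X, derivative_C, derivative_natCast, derivative_add,
      derivative_one]
    push_cast
    ring

-- The inductive step: inserting the factor `a / a` separates the same ratio with one zero and one
-- derivative fewer from a Möbius function of `x`.
open Polynomial in
theorem posLog_ratio_derivative_step (p : ℂ[X]) (x z : ℂ) (l : ℕ)
    (hp : (derivative^[l] p).eval z ≠ 0) :
    Real.posLog (‖((X - C x) * p).eval z‖ / ‖(derivative^[l + 1] ((X - C x) * p)).eval z‖) ≤
      Real.posLog (‖p.eval z‖ / ‖(derivative^[l] p).eval z‖) +
        (Real.log 2 + 3 * Real.posLog ‖z - x‖ + Real.posLog ‖x - (z + (l + 1) *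
          ((derivative^[l] p).eval z / (derivative^[l + 1] p).eval z))‖⁻¹) := by
  have h1 := posLog_norm_moebius_le (z - x) ((derivative^[l] p).eval z)
    ((derivative^[l + 1] p).eval z) l
  rw [iterate_derivative_X_sub_C_mul]
  simp only [eval_mul, eval_add, eval_sub, eval_X, eval_C, eval_natCast, eval_one]
  set a := (derivative^[l] p).eval z
  set b := (derivative^[l + 1] p).eval z
  have h2 : ‖(z - x) * p.eval z‖ / ‖(z - x) * b + (l + 1) * a‖ =
      ‖p.eval z‖ / ‖a‖ * ‖(z - x) * a / ((z - x) * b + (l + 1) * a)‖ := by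
    have : ‖a‖ ≠ 0 := norm_ne_zero_iff.2 hp
    rw [norm_mul, norm_div, norm_mul]
    field_simp
  rw [h2, norm_sub_rev x, add_sub_right_comm]
  exact Real.posLog_mul.trans (by gcongr)

/-! ### Expected `log⁺` of the polynomial over its derivative, by induction on the order -/

open Polynomial in
/-- The polynomial `A` times the product of `t - w j` over `j ∈ s`. -/
noncomputable def polyMulRoots {k : ℕ} (A : ℂ[X]) (s : Finset (Fin k)) (w : Fin k → ℂ) : ℂ[X] :=
  A * ∏ j ∈ s, (X - C (w j))

section polyMulRoots

open Polynomial

variable {k : ℕ} {A : ℂ[X]} {s : Finset (Fin k)} {i : Fin k}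

theorem polyMulRoots_insert (hi : i ∉ s) (w : Fin k → ℂ) :
    polyMulRoots A (insert i s) w = (X - C (w i)) * polyMulRoots A s w := by
  rw [polyMulRoots, Finset.prod_insert hi, polyMulRoots, mul_left_comm]

theorem polyMulRoots_update (hi : i ∉ s) (w : Fin k → ℂ) (v : ℂ) :
    polyMulRoots A s (Function.update w i v) = polyMulRoots A s w := by
  rw [polyMulRoots, polyMulRoots]
  congr 1
  refine Finset.prod_congr rfl fun j hj => ?_
  rw [Function.update_of_ne (fun h : j = i => hi (h ▸ hj))]

theorem monic_polyMulRoots (hA : A.Monic) (w : Fin k → ℂ) : (polyMulRoots A s w).Monic :=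
  hA.mul (monic_prod_of_monic _ _ fun j _ => monic_X_sub_C (w j))

theorem natDegree_polyMulRoots (hA : A.Monic) (w : Fin k → ℂ) :
    (polyMulRoots A s w).natDegree = A.natDegree + s.card := by
  rw [polyMulRoots, hA.natDegree_mul (monic_prod_of_monic _ _ fun j _ => monic_X_sub_C (w j)),
    natDegree_prod_of_monic _ _ fun j _ => monic_X_sub_C (w j)]
  simp

/-- Joint continuity in the point and the zeros supplies the measurability needed for Tonelli and
Markov. The order `l` must vary, as adding a zero involves two orders. -/
theorem continuous_eval_iterate_derivative_polyMulRoots (A : ℂ[X]) (s : Finset (Fin k)) (l : ℕ) :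
    Continuous fun q : ℂ × (Fin k → ℂ) => (derivative^[l] (polyMulRoots A s q.2)).eval q.1 := by
  induction s using Finset.induction_on generalizing l with
  | empty =>
    simp only [polyMulRoots, Finset.prod_empty, mul_one]
    exact (derivative^[l] A).continuous.comp continuous_fst
  | insert i s hi ih =>
    simp only [polyMulRoots_insert hi]
    cases l with
    | zero =>
      simp only [Function.iterate_zero, id_eq, eval_mul, eval_sub, eval_X, eval_C]
      have := ih 0
      simp only [Function.iterate_zero, id_eq] at this
      fun_prop
    | succ l =>
      simp only [iterate_derivative_X_sub_C_mul, eval_add, eval_mul, eval_sub, eval_X, eval_C,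
        eval_natCast, eval_one]
      have h1 := ih (l + 1)
      have h2 := ih l
      fun_prop

theorem measurable_logRatioIntegral_polyMulRoots (D : Set ℂ) (A : ℂ[X]) (s : Finset (Fin k))
    (l : ℕ) : Measurable fun w : Fin k → ℂ =>
      logRatioIntegral D (polyMulRoots A s w) (derivative^[l] (polyMulRoots A s w)) := by
  unfold logRatioIntegral
  have h0 := continuous_eval_iterate_derivative_polyMulRoots A s 0
  have h1 := continuous_eval_iterate_derivative_polyMulRoots A s l
  simp only [Function.iterate_zero, id_eq] at h0
  exact Measurable.lintegral_prod_left' (f := fun q : ℂ × (Fin k → ℂ) => ENNReal.ofReal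
    (Real.posLog (‖(polyMulRoots A s q.2).eval q.1‖ /
      ‖(derivative^[l] (polyMulRoots A s q.2)).eval q.1‖)))
    (Real.continuous_posLog.measurable.comp
      (h0.norm.measurable.div h1.norm.measurable)).ennreal_ofReal

/-- The point at which the `l + 1`-st derivative of `(t - x) p` vanishes at `z` if `x` is this
point, for `p = polyMulRoots A s w`. -/
noncomputable def singularPoint (A : ℂ[X]) (s : Finset (Fin k)) (l : ℕ)
    (z : ℂ) (w : Fin k → ℂ) : ℂ :=
  z + (l + 1) * ((derivative^[l] (polyMulRoots A s w)).eval z /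
    (derivative^[l + 1] (polyMulRoots A s w)).eval z)

theorem measurable_singularPoint (A : ℂ[X]) (s : Finset (Fin k)) (l : ℕ) :
    Measurable fun q : ℂ × (Fin k → ℂ) => singularPoint A s l q.1 q.2 := by
  have h1 := (continuous_eval_iterate_derivative_polyMulRoots A s l).measurable
  have h2 := (continuous_eval_iterate_derivative_polyMulRoots A s (l + 1)).measurable
  exact measurable_fst.add ((h1.div h2).const_mul _)

theorem logRatioIntegral_polyMulRoots_insert_le (hA : A.Monic) (hi : i ∉ s) {l : ℕ}
    (hl : l ≤ s.card) (R : ℝ) (w : Fin k → ℂ) :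
    logRatioIntegral (Metric.closedBall 0 R) (polyMulRoots A (insert i s) w)
        (derivative^[l + 1] (polyMulRoots A (insert i s) w)) ≤
      logRatioIntegral (Metric.closedBall 0 R) (polyMulRoots A s w)
        (derivative^[l] (polyMulRoots A s w)) +
      ∫⁻ z in Metric.closedBall 0 R, (ENNReal.ofReal (4 * Real.log 2 + 3 * Real.posLog R) +
        3 * ENNReal.ofReal (Real.posLog ‖w i‖) +
        ENNReal.ofReal (Real.posLog ‖w i - singularPoint A s l z w‖⁻¹)) := by
  have h0 : derivative^[l] (polyMulRoots A s w) ≠ 0 :=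
    iterate_derivative_ne_zero (monic_polyMulRoots hA w).ne_zero
      (by rw [natDegree_polyMulRoots hA]; lia)
  unfold logRatioIntegral
  rw [← lintegral_add_left (measurable_posLog_ratio _ _)]
  refine lintegral_mono_ae ?_
  filter_upwards [ae_eval_ne_zero h0 _, ae_restrict_mem Metric.isClosed_closedBall.measurableSet]
    with z hz hzR
  have hzR' : ‖z‖ ≤ R := mem_closedBall_zero_iff.1 hzR
  have h1 := posLog_ratio_derivative_step (polyMulRoots A s w) (w i) z l hz
  rw [← polyMulRoots_insert hi] at h1
  -- Taken three times and added to the `log 2` of the pointwise bound, this gives the constant `4 *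
  -- log 2 + 3 * log⁺ R`.
  have h2 : Real.posLog ‖z - w i‖ ≤ Real.log 2 + Real.posLog R + Real.posLog ‖w i‖ := by
    have := Real.posLog_norm_add_le z (-w i)
    rw [← sub_eq_add_neg, norm_neg] at this
    linarith [Real.posLog_le_posLog (norm_nonneg _) hzR']
  have hlog : 0 < Real.log 2 := Real.log_pos one_lt_two
  have hR := Real.posLog_nonneg (x := R)
  have hw := Real.posLog_nonneg (x := ‖w i‖)
  have h3 : (3 : ℝ≥0∞) = ENNReal.ofReal 3 := by simp
  rw [h3, ← ENNReal.ofReal_mul (by norm_num), ← ENNReal.ofReal_add (by linarith) (by linarith),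
    ← ENNReal.ofReal_add (by linarith) Real.posLog_nonneg,
    ← ENNReal.ofReal_add Real.posLog_nonneg (add_nonneg (by linarith) Real.posLog_nonneg)]
  refine ENNReal.ofReal_le_ofReal (h1.trans ?_)
  rw [singularPoint]
  linarith

/-- Each derivative is paid for by one zero taken from `s`, down to the ratio of a polynomial with
itself. The singular point for the removed zero depends only on those that remain, so at each fixed
`z` the conditional density bound applies; Tonelli then integrates over the disc. -/
theorem lintegral_logRatioIntegral_le (hA : A.Monic) {ν : (Fin k → ℂ) → ℝ≥0∞}
    (hν : Measurable ν) (hν1 : ∫⁻ w, ν w = 1) {B : ℝ} (hB : 0 < B)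
    (hcond : ∀ (i : Fin k) (w : Fin k → ℂ), (⨆ v : ℂ, ν (Function.update w i v)) ≤
        ENNReal.ofReal B * ∫⁻ v : ℂ, ν (Function.update w i v))
    {C₁ : ℝ≥0∞} (hlog : ∫⁻ w, (∑ i, ENNReal.ofReal (Real.posLog ‖w i‖)) * ν w ≤ C₁)
    (R : ℝ) {l : ℕ} (hl : l ≤ s.card) :
    ∫⁻ w, logRatioIntegral (Metric.closedBall 0 R) (polyMulRoots A s w)
        (derivative^[l] (polyMulRoots A s w)) * ν w ≤
      l * ((ENNReal.ofReal (4 * Real.log 2 + 3 * Real.posLog R) + 3 * C₁ +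
        (ENNReal.ofReal (Real.posLog B) + discInvNormIntegral)) *
        volume (Metric.closedBall (0 : ℂ) R)) := by
  induction l generalizing s with
  | zero => simp [logRatioIntegral_self]
  | succ l ih =>
    obtain ⟨i, hi⟩ : s.Nonempty := Finset.card_pos.1 (by lia)
    obtain ⟨t, hit, rfl⟩ : ∃ t, i ∉ t ∧ s = insert i t :=
      ⟨s.erase i, Finset.notMem_erase i s, (Finset.insert_erase hi).symm⟩
    rw [Finset.card_insert_of_notMem hit, add_le_add_iff_right] at hl
    set c := ENNReal.ofReal (4 * Real.log 2 + 3 * Real.posLog R)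
    set D := Metric.closedBall (0 : ℂ) R
    set T : (Fin k → ℂ) → ℂ → ℝ≥0∞ := fun w z => c + 3 * ENNReal.ofReal (Real.posLog ‖w i‖) +
        ENNReal.ofReal (Real.posLog ‖w i - singularPoint A t l z w‖⁻¹) with hT
    have hpm : Measurable Real.posLog := Real.continuous_posLog.measurable
    have hsp : Measurable fun q : (Fin k → ℂ) × ℂ => singularPoint A t l q.2 q.1 :=
      (measurable_singularPoint A t l).comp measurable_swap
    have hTm : Measurable fun q : (Fin k → ℂ) × ℂ => T q.1 q.2 := by
      have h1 : Measurable fun q : (Fin k → ℂ) × ℂ => ENNReal.ofReal (Real.posLog ‖q.1 i‖) :=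
        (hpm.comp (by fun_prop)).ennreal_ofReal
      have h2 : Measurable fun q : (Fin k → ℂ) × ℂ => q.1 i - singularPoint A t l q.2 q.1 :=
        ((measurable_pi_apply i).comp measurable_fst).sub hsp
      have h3 : Measurable fun q : (Fin k → ℂ) × ℂ =>
          ENNReal.ofReal (Real.posLog ‖q.1 i - singularPoint A t l q.2 q.1‖⁻¹) :=
        (hpm.comp h2.norm.inv).ennreal_ofReal
      exact (measurable_const.add (h1.const_mul 3)).add h3
    have hpl : Measurable fun w : Fin k → ℂ => ENNReal.ofReal (Real.posLog ‖w i‖) :=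
      (hpm.comp (by fun_prop)).ennreal_ofReal
    have hTν : ∀ z, ∫⁻ w, T w z * ν w ≤
        c + 3 * C₁ + (ENNReal.ofReal (Real.posLog B) + discInvNormIntegral) := by
      intro z
      have hs : Measurable fun w : Fin k → ℂ => singularPoint A t l z w :=
        (measurable_singularPoint A t l).comp measurable_prodMk_left
      have hm1 : Measurable fun w : Fin k → ℂ => c * ν w := hν.const_mul c
      have hm2 : Measurable fun w : Fin k → ℂ => ENNReal.ofReal (Real.posLog ‖w i‖) * ν w :=
        hpl.mul hν
      have hm3 : Measurable fun w : Fin k → ℂ =>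
          c * ν w + 3 * (ENNReal.ofReal (Real.posLog ‖w i‖) * ν w) := hm1.add (hm2.const_mul 3)
      simp only [hT, add_mul, mul_assoc]
      rw [lintegral_add_left hm3, lintegral_add_left hm1, lintegral_const_mul _ hν, hν1, mul_one,
        lintegral_const_mul _ hm2]
      gcongr
      · refine le_trans (lintegral_mono fun w => ?_) hlog
        gcongr
        exact Finset.single_le_sum (f := fun i => ENNReal.ofReal (Real.posLog ‖w i‖))
          (fun _ _ => zero_le) (Finset.mem_univ i)
      · refine lintegral_posLog_inv_norm_sub_le hν hν1 hB (hcond i) hs fun w v => ?_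
        simp only [singularPoint, polyMulRoots_update hit]
    have hstep : ∀ w, logRatioIntegral D (polyMulRoots A (insert i t) w)
        (derivative^[l + 1] (polyMulRoots A (insert i t) w)) ≤ logRatioIntegral D
          (polyMulRoots A t w) (derivative^[l] (polyMulRoots A t w)) + ∫⁻ z in D, T w z :=
      fun w => logRatioIntegral_polyMulRoots_insert_le hA hit hl R w
    have hm : Measurable fun w => logRatioIntegral D (polyMulRoots A t w)
        (derivative^[l] (polyMulRoots A t w)) * ν w :=
      (measurable_logRatioIntegral_polyMulRoots D A t l).mul hν
    have ih' := ih hl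
    clear_value T D c
    set M := c + 3 * C₁ + (ENNReal.ofReal (Real.posLog B) + discInvNormIntegral)
    clear_value M
    calc ∫⁻ w, logRatioIntegral D (polyMulRoots A (insert i t) w)
          (derivative^[l + 1] (polyMulRoots A (insert i t) w)) * ν w
        ≤ ∫⁻ w, (logRatioIntegral D (polyMulRoots A t w)
            (derivative^[l] (polyMulRoots A t w)) * ν w + ∫⁻ z in D, T w z * ν w) := by
          refine lintegral_mono fun w => ?_
          have hTw : Measurable (T w) := hTm.comp measurable_prodMk_left
          rw [lintegral_mul_const _ hTw, ← add_mul]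
          gcongr
          exact hstep w
      _ = (∫⁻ w, logRatioIntegral D (polyMulRoots A t w)
            (derivative^[l] (polyMulRoots A t w)) * ν w) + ∫⁻ z in D, ∫⁻ w, T w z * ν w := by
          rw [lintegral_add_left hm, lintegral_lintegral_swap]
          exact (hTm.mul (hν.comp measurable_fst)).aemeasurable
      _ ≤ l * (M * volume D) + M * volume D := by
          refine add_le_add ih' ?_
          rw [← setLIntegral_const]
          exact lintegral_mono hTν
      _ = (l + 1 : ℕ) * (M * volume D) := by
          rw [Nat.cast_succ, add_mul (l : ℝ≥0∞) 1, one_mul]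

end polyMulRoots

/-! ### Empirical measures -/

theorem isFiniteMeasure_multiset_sum_dirac (s : Multiset ℂ) :
    IsFiniteMeasure (s.map fun a => Measure.dirac a).sum := by
  induction s using Multiset.induction_on with
  | empty => rw [Multiset.map_zero, Multiset.sum_zero]; infer_instance
  | cons a s ih => rw [Multiset.map_cons, Multiset.sum_cons]; infer_instance

theorem integral_multiset_sum_dirac (f : ℂ →ᵇ ℝ) (s : Multiset ℂ) :
    ∫ x, f x ∂(s.map fun a => Measure.dirac a).sum = (s.map f).sum := by
  induction s using Multiset.induction_on with
  | empty => simp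
  | cons a s ih =>
    have := isFiniteMeasure_multiset_sum_dirac s
    rw [Multiset.map_cons, Multiset.sum_cons, Multiset.map_cons, Multiset.sum_cons,
      integral_add_measure (f.integrable _) (f.integrable _), ih, integral_dirac]

theorem integral_empiricalMeasure (f : ℂ →ᵇ ℝ) (s : Multiset ℂ) :
    ∫ x, f x ∂(empiricalMeasure s) = (s.card : ℝ)⁻¹ * (s.map f).sum := by
  rw [empiricalMeasure, integral_smul_measure, integral_multiset_sum_dirac, ENNReal.toReal_inv,
    ENNReal.toReal_natCast, smul_eq_mul]

theorem isProbabilityMeasure_empiricalMeasure {s : Multiset ℂ} (hs : s.card ≠ 0) :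
    IsProbabilityMeasure (empiricalMeasure s) := by
  refine ⟨?_⟩
  have h : ∀ t : Multiset ℂ, (t.map fun a => Measure.dirac a).sum Set.univ = t.card := by
    intro t
    induction t using Multiset.induction_on with
    | empty => simp
    | cons a t ih =>
      rw [Multiset.map_cons, Multiset.sum_cons, Measure.add_apply, ih]
      simp [add_comm]
  rw [empiricalMeasure, Measure.smul_apply, h, smul_eq_mul, ENNReal.inv_mul_cancel]
  · exact_mod_cast hs
  · exact ENNReal.natCast_ne_top _

theorem abs_multiset_sum_le {f : ℂ → ℝ} {F : ℝ} (hF : ∀ z, |f z| ≤ F) (s : Multiset ℂ) :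
    |(s.map f).sum| ≤ s.card * F := by
  induction s using Multiset.induction_on with
  | empty => simp
  | cons a s ih =>
    rw [Multiset.map_cons, Multiset.sum_cons, Multiset.card_cons]
    push_cast
    linarith [abs_add_le (f a) (s.map f).sum, hF a]

/-- Replacing the normalisation `1 / card t` by `1 / n` costs at most `k * F / n`, as the sum over
`t` is at most `card t * F`. -/
theorem abs_average_sub_average_le {f : ℂ → ℝ} {F : ℝ} (hF : ∀ z, |f z| ≤ F) {s t : Multiset ℂ}
    {n k : ℕ} (hn : 1 ≤ n) (hs : s.card = n) (h1 : n ≤ t.card) (h2 : t.card ≤ n + k) :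
    |(t.card : ℝ)⁻¹ * (t.map f).sum - (s.card : ℝ)⁻¹ * (s.map f).sum| ≤
      (n : ℝ)⁻¹ * (|(t.map f).sum - (s.map f).sum| + k * F) := by
  have hF0 : 0 ≤ F := (abs_nonneg _).trans (hF 0)
  have hn0 : (0 : ℝ) < n := by exact_mod_cast hn
  have hm : (n : ℝ) ≤ t.card := by exact_mod_cast h1
  have hm0 : (0 : ℝ) < t.card := by linarith
  have hmk : (t.card : ℝ) ≤ n + k := by exact_mod_cast h2
  have h3 : (t.card : ℝ)⁻¹ * (t.map f).sum - (s.card : ℝ)⁻¹ * (s.map f).sum =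
      (n : ℝ)⁻¹ * (((t.map f).sum - (s.map f).sum) -
        (t.card - n) * ((t.card : ℝ)⁻¹ * (t.map f).sum)) := by
    rw [hs]; field_simp; ring
  rw [h3, abs_mul, abs_of_pos (inv_pos.2 hn0)]
  gcongr
  refine (abs_sub _ _).trans ?_
  gcongr
  rw [abs_mul, abs_mul, abs_of_nonneg (sub_nonneg.2 hm), abs_of_pos (inv_pos.2 hm0)]
  gcongr
  · linarith
  · rw [inv_mul_le_iff₀ hm0]
    exact abs_multiset_sum_le hF t

/-! ### Reduction to compactly supported test functions -/

/-- A radial continuous cutoff function. -/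
noncomputable def radialCutoff (R : ℝ) : ℂ →ᵇ ℝ :=
  BoundedContinuousFunction.ofNormedAddCommGroup (fun z => max 0 (min 1 (R + 1 - ‖z‖)))
    (by fun_prop) 1 (fun z => by
      rw [Real.norm_of_nonneg (le_max_left _ _)]
      exact max_le zero_le_one (min_le_left _ _))

theorem radialCutoff_apply (R : ℝ) (z : ℂ) :
    radialCutoff R z = max 0 (min 1 (R + 1 - ‖z‖)) := rfl

theorem radialCutoff_nonneg (R : ℝ) (z : ℂ) : 0 ≤ radialCutoff R z := le_max_left _ _

theorem radialCutoff_le_one (R : ℝ) (z : ℂ) : radialCutoff R z ≤ 1 :=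
  max_le zero_le_one (min_le_left _ _)

theorem hasCompactSupport_radialCutoff (R : ℝ) : HasCompactSupport (radialCutoff R) := by
  refine HasCompactSupport.intro (isCompact_closedBall (0 : ℂ) (R + 1)) fun u hu => ?_
  rw [mem_closedBall_zero_iff, not_le] at hu
  rw [radialCutoff_apply, max_eq_left]
  exact (min_le_right _ _).trans (by linarith)

theorem tendsto_integral_radialCutoff (μ : Measure ℂ) [IsProbabilityMeasure μ] :
    Tendsto (fun R : ℕ => ∫ z, radialCutoff R z ∂μ) atTop (𝓝 1) := by
  have h : Tendsto (fun R : ℕ => ∫ z, radialCutoff R z ∂μ) atTop (𝓝 (∫ _, (1 : ℝ) ∂μ)) := by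
    refine tendsto_integral_of_dominated_convergence (fun _ => 1)
      (fun R => (radialCutoff R).continuous.aestronglyMeasurable) (integrable_const _)
      (fun R => ae_of_all _ fun z => ?_) (ae_of_all _ fun z => ?_)
    · rw [Real.norm_of_nonneg (radialCutoff_nonneg _ _)]
      exact radialCutoff_le_one _ _
    · refine tendsto_const_nhds.congr' ?_
      filter_upwards [eventually_ge_atTop ⌈‖z‖⌉₊] with R hR
      have : ‖z‖ ≤ R := (Nat.le_ceil _).trans (by exact_mod_cast hR)
      rw [radialCutoff_apply, min_eq_left (by linarith), max_eq_right zero_le_one]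
  simpa using h

theorem abs_integral_sub_integral_cutoff_le (μ : Measure ℂ) [IsProbabilityMeasure μ] (f : ℂ →ᵇ ℝ)
    (R : ℝ) : |∫ z, f z ∂μ - ∫ z, (f * radialCutoff R) z ∂μ| ≤
      ‖f‖ * (1 - ∫ z, radialCutoff R z ∂μ) := by
  have h1 : Integrable (fun z => 1 - radialCutoff R z) μ :=
    (integrable_const 1).sub ((radialCutoff R).integrable μ)
  rw [← integral_sub (f.integrable μ) ((f * radialCutoff R).integrable μ)]
  have h2 : ∫ z, (1 - radialCutoff R z) ∂μ = 1 - ∫ z, radialCutoff R z ∂μ := by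
    rw [integral_sub (integrable_const 1) ((radialCutoff R).integrable μ)]
    simp
  rw [← h2, ← integral_const_mul, ← Real.norm_eq_abs]
  refine norm_integral_le_of_norm_le (h1.const_mul _) (ae_of_all _ fun z => ?_)
  have h3 : f z - (f * radialCutoff R) z = f z * (1 - radialCutoff R z) := by
    rw [BoundedContinuousFunction.mul_apply]; ring
  have h4 := radialCutoff_le_one R z
  rw [h3, norm_mul, Real.norm_of_nonneg (by linarith : 0 ≤ 1 - radialCutoff R z)]
  exact mul_le_mul_of_nonneg_right (f.norm_coe_le_norm z) (by linarith)

/-- For random probability measures with a deterministic probability measure as the limit, it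
suffices to test convergence in probability against compactly supported functions. -/
theorem tendstoWeaklyInProbability_of_hasCompactSupport {Ω : Type*} [MeasurableSpace Ω]
    {P : Measure Ω} {M : ℕ → Ω → Measure ℂ} {μ : Measure ℂ} [IsProbabilityMeasure μ]
    (hM : ∀ᶠ n in atTop, ∀ ω, IsProbabilityMeasure (M n ω))
    (h : ∀ f : ℂ →ᵇ ℝ, HasCompactSupport f →
      TendstoInMeasure P (fun n ω => ∫ x, f x ∂(M n ω)) atTop (fun _ => ∫ x, f x ∂μ)) :
    TendstoWeaklyInProbability P M μ := by
  intro f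
  rw [tendstoInMeasure_iff_dist]
  intro η hη
  -- If the cutoff integrals differ by less than `δ`, then `M n ω` gives `1 - radialCutoff R`
  -- integral at most `2 * δ`. The errors are `η / 3` for `M n ω`, `η / 6` for `μ` and less than `η
  -- / 2` for the truncated function, in total less than `η`.
  set δ := η / (6 * (‖f‖ + 1)) with hδ
  have hf0 := norm_nonneg f
  have hδ0 : 0 < δ := by positivity
  have hfδ : ‖f‖ * δ ≤ η / 6 := by
    rw [hδ, ← mul_div_assoc, div_le_div_iff₀ (by positivity) (by norm_num)]
    nlinarith
  obtain ⟨R, hR⟩ := ((tendsto_integral_radialCutoff μ).eventually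
    (lt_mem_nhds (by linarith : 1 - δ < 1))).exists
  have h1 := tendstoInMeasure_iff_dist.1 (h _ (hasCompactSupport_radialCutoff R)) δ hδ0
  have h2 := tendstoInMeasure_iff_dist.1 (h (f * radialCutoff R)
    (hasCompactSupport_radialCutoff R).mul_left) (η / 2) (half_pos hη)
  have h12 := h1.add h2
  rw [add_zero] at h12
  refine tendsto_of_tendsto_of_tendsto_of_le_of_le' tendsto_const_nhds h12
    (Eventually.of_forall fun _ => zero_le) ?_
  filter_upwards [hM] with n hn
  refine (measure_mono fun ω hω => ?_).trans (measure_union_le _ _)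
  have := hn ω
  by_contra hcon
  simp only [Set.mem_union, Set.mem_ofPred_eq, not_or, not_le, Real.dist_eq] at hcon hω
  obtain ⟨hc1, hc2⟩ := hcon
  have e1 := abs_integral_sub_integral_cutoff_le (M n ω) f R
  have e2 := abs_integral_sub_integral_cutoff_le μ f R
  have e3 : ‖f‖ * (1 - ∫ z, radialCutoff R z ∂(M n ω)) ≤ ‖f‖ * (2 * δ) := by
    gcongr
    have := (abs_lt.1 hc1).1
    linarith
  have e4 : ‖f‖ * (1 - ∫ z, radialCutoff R z ∂μ) ≤ ‖f‖ * δ := by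
    gcongr
    linarith
  have e5 := (abs_le.1 (e1.trans e3))
  have e6 := (abs_le.1 (e2.trans e4))
  have e7 := abs_lt.1 hc2
  rcases le_abs.1 hω with hω | hω <;> linarith

/-! ### The polynomial `P_n`: its zeros and leading coefficients -/

theorem polyWithZeros_eq {n k : ℕ} (a : Fin n → ℂ) (b : Fin k → ℂ) :
    polyWithZeros a b =
      polyMulRoots (∏ i, (Polynomial.X - Polynomial.C (a i))) Finset.univ b := rfl

theorem monic_prod_X_sub_C {n : ℕ} (a : Fin n → ℂ) :
    (∏ i, (Polynomial.X - Polynomial.C (a i))).Monic :=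
  Polynomial.monic_prod_of_monic _ _ fun i _ => Polynomial.monic_X_sub_C (a i)

theorem monic_polyWithZeros {n k : ℕ} (a : Fin n → ℂ) (b : Fin k → ℂ) :
    (polyWithZeros a b).Monic :=
  monic_polyMulRoots (monic_prod_X_sub_C a) b

theorem natDegree_polyWithZeros {n k : ℕ} (a : Fin n → ℂ) (b : Fin k → ℂ) :
    (polyWithZeros a b).natDegree = n + k := by
  rw [polyWithZeros_eq, natDegree_polyMulRoots (monic_prod_X_sub_C a), Finset.card_fin,
    Polynomial.natDegree_prod_of_monic _ _ fun i _ => Polynomial.monic_X_sub_C (a i)]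
  simp

theorem roots_polyWithZeros {n k : ℕ} (a : Fin n → ℂ) (b : Fin k → ℂ) :
    (polyWithZeros a b).roots = Finset.univ.val.map a + Finset.univ.val.map b := by
  have h : ∀ {m : ℕ} (c : Fin m → ℂ),
      (∏ i, (Polynomial.X - Polynomial.C (c i))).roots = Finset.univ.val.map c := by
    intro m c
    have := Polynomial.roots_multiset_prod_X_sub_C (Finset.univ.val.map c)
    rwa [Multiset.map_map] at this
  rw [polyWithZeros, Polynomial.roots_mul
    ((monic_prod_X_sub_C a).mul (monic_prod_X_sub_C b)).ne_zero, h, h]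

open Polynomial in
theorem card_roots_iterate_derivative_polyWithZeros {n k : ℕ} (a : Fin n → ℂ) (b : Fin k → ℂ)
    {l : ℕ} (hl : l ≤ k) :
    (derivative^[l] (polyWithZeros a b)).roots.card = n + k - l := by
  rw [card_roots_eq, natDegree_iterate_derivative_eq (monic_polyWithZeros a b).ne_zero
    (by rw [natDegree_polyWithZeros]; lia), natDegree_polyWithZeros]

open Polynomial in
/-- Deterministic comparison between the zeros of a derivative and the prescribed zeros. -/
theorem abs_integral_zeroMeasure_sub_le (f : ℂ →ᵇ ℝ) {n k : ℕ} (hn : 1 ≤ n) (a : Fin n → ℂ)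
    (b : Fin k → ℂ) {l : ℕ} (hl : l ≤ k) :
    |∫ x, f x ∂(zeroMeasure (derivative^[l] (polyWithZeros a b))) -
        ∫ x, f x ∂(empiricalMeasure (Finset.univ.val.map a))| ≤
      (n : ℝ)⁻¹ * (|((derivative^[l] (polyWithZeros a b)).roots.map f).sum -
        ((polyWithZeros a b).roots.map f).sum| + 2 * k * ‖f‖) := by
  have hF : ∀ z, |f z| ≤ ‖f‖ := fun z => f.norm_coe_le_norm z
  have hc := card_roots_iterate_derivative_polyWithZeros a b hl
  rw [zeroMeasure, integral_empiricalMeasure, integral_empiricalMeasure]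
  refine (abs_average_sub_average_le hF hn (by simp) (by lia) (by lia : _ ≤ n + k)).trans ?_
  refine mul_le_mul_of_nonneg_left ?_ (by positivity)
  -- Of the term `2 * k * ‖f‖`, one half comes from the change of normalisation and the other from
  -- discarding the zeros `b`.
  have h1 : ((polyWithZeros a b).roots.map f).sum = ((Finset.univ.val.map a).map f).sum +
      ((Finset.univ.val.map b).map f).sum := by
    rw [roots_polyWithZeros, Multiset.map_add, Multiset.sum_add]
  have h2 := abs_multiset_sum_le hF (Finset.univ.val.map b)
  simp only [Multiset.card_map, Finset.card_val, Finset.card_fin] at h2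
  have h3 := abs_add_le (((derivative^[l] (polyWithZeros a b)).roots.map f).sum -
    ((polyWithZeros a b).roots.map f).sum) ((Finset.univ.val.map b).map f).sum
  rw [h1, sub_add_eq_sub_sub, sub_add_cancel] at h3
  rw [h1, sub_add_eq_sub_sub]
  linarith

-- The leading coefficient is a falling factorial, which lies between `1` and the `l`-th power of
-- the degree.
open Polynomial in
theorem abs_log_leadingCoeff_iterate_derivative_le {p : ℂ[X]} (hp : p.Monic) {l : ℕ}
    (hl : l ≤ p.natDegree) :
    |Real.log ‖(derivative^[l] p).leadingCoeff‖ - Real.log ‖p.leadingCoeff‖| ≤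
      l * Real.log p.natDegree := by
  have h1 : 1 ≤ p.natDegree.descFactorial l :=
    Nat.one_le_iff_ne_zero.2 (by simpa [Nat.descFactorial_eq_zero_iff_lt] using hl)
  have h1' : (1 : ℝ) ≤ p.natDegree.descFactorial l := by exact_mod_cast h1
  rw [leadingCoeff_iterate_derivative_eq hp.ne_zero hl, hp.leadingCoeff, mul_one,
    Complex.norm_natCast, norm_one, Real.log_one, sub_zero, abs_of_nonneg (Real.log_nonneg h1'),
    ← Real.log_pow]
  refine Real.log_le_log (by linarith) ?_
  exact_mod_cast Nat.descFactorial_le_pow _ _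

/-! ### Sublinear growth of the error -/

/-- An upper bound, up to a constant factor, for the expected distance of the logarithmic
potentials of a polynomial and of its derivatives. -/
noncomputable def logErrorGrowth (k : ℕ) (a : ℝ) (n : ℕ) : ℝ :=
  1 + Real.log (1 + k) + Real.log n + (n : ℝ) ^ a

theorem one_le_logErrorGrowth (k : ℕ) (a : ℝ) (n : ℕ) : 1 ≤ logErrorGrowth k a n := by
  have h1 : 0 ≤ Real.log (1 + k) := Real.log_nonneg (by simp)
  have h2 := Real.log_natCast_nonneg n
  have h3 : 0 ≤ (n : ℝ) ^ a := by positivity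
  unfold logErrorGrowth
  linarith

theorem log_natCast_add_le_logErrorGrowth (k : ℕ) (a : ℝ) {n : ℕ} (hn : 1 ≤ n) :
    Real.log (n + k : ℕ) ≤ logErrorGrowth k a n := by
  have hn' : (1 : ℝ) ≤ n := by exact_mod_cast hn
  have h3 : 0 ≤ (n : ℝ) ^ a := by positivity
  have h4 : Real.log (n + k : ℕ) ≤ Real.log ((1 + k) * n) := by
    refine Real.log_le_log (by positivity) ?_
    push_cast
    nlinarith [(Nat.cast_nonneg k : (0 : ℝ) ≤ k)]
  rw [Real.log_mul (by positivity) (by positivity)] at h4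
  unfold logErrorGrowth
  linarith

theorem rpow_le_logErrorGrowth (k : ℕ) (a : ℝ) (n : ℕ) : (n : ℝ) ^ a ≤ logErrorGrowth k a n := by
  have h1 : 0 ≤ Real.log (1 + k) := Real.log_nonneg (by simp)
  have h2 := Real.log_natCast_nonneg n
  unfold logErrorGrowth
  linarith

theorem tendsto_logErrorGrowth_div (k : ℕ) {a : ℝ} (ha : a < 1) :
    Tendsto (fun n : ℕ => logErrorGrowth k a n / n) atTop (𝓝 0) := by
  have h1 : Tendsto (fun n : ℕ => (1 + Real.log (1 + k)) / (n : ℝ)) atTop (𝓝 0) :=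
    tendsto_const_div_atTop_nhds_zero_nat _
  have h2 : Tendsto (fun n : ℕ => Real.log n / (n : ℝ)) atTop (𝓝 0) :=
    (Real.isLittleO_log_id_atTop.tendsto_div_nhds_zero).comp tendsto_natCast_atTop_atTop
  have h3 : Tendsto (fun n : ℕ => (n : ℝ) ^ a / (n : ℝ)) atTop (𝓝 0) := by
    have h4 : Tendsto (fun n : ℕ => (n : ℝ) ^ (-(1 - a))) atTop (𝓝 0) :=
      (tendsto_rpow_neg_atTop (sub_pos.2 ha)).comp tendsto_natCast_atTop_atTop
    refine h4.congr' ?_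
    filter_upwards [eventually_ge_atTop 1] with n hn
    have hn' : (0 : ℝ) < n := by exact_mod_cast hn
    rw [neg_sub, Real.rpow_sub_one hn'.ne']
  have h := (h1.add h2).add h3
  simp only [add_zero] at h
  refine h.congr fun n => ?_
  simp only [logErrorGrowth, add_div]

open Polynomial in
/-- The part of the error bound which comes from `log⁺ |p⁽ˡ⁾ / p|` and the leading coefficient. -/
theorem logRatioIntegral_add_leadingCoeff_le (D : Set ℂ) {n k : ℕ} (hn : 1 ≤ n) (z : Fin n → ℂ)
    (w : Fin k → ℂ) (a : ℝ) {l : ℕ} (hl : l ≤ k) :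
    logRatioIntegral D (derivative^[l] (polyWithZeros z w)) (polyWithZeros z w) +
        ENNReal.ofReal |Real.log ‖(derivative^[l] (polyWithZeros z w)).leadingCoeff‖ -
          Real.log ‖(polyWithZeros z w).leadingCoeff‖| * volume D ≤
      l * (3 * volume D + discInvNormIntegral) * ENNReal.ofReal (logErrorGrowth k a n) := by
  have hm := monic_polyWithZeros z w
  have hd := natDegree_polyWithZeros z w
  have hld : l ≤ (polyWithZeros z w).natDegree := by rw [hd]; lia
  set t := ENNReal.ofReal (logErrorGrowth k a n) with ht
  have ht1 : 1 ≤ t := ENNReal.one_le_ofReal.2 (one_le_logErrorGrowth k a n)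
  have hlog : ENNReal.ofReal (Real.log (n + k : ℕ)) ≤ t :=
    ENNReal.ofReal_le_ofReal (log_natCast_add_le_logErrorGrowth k a hn)
  have h1 := logRatioIntegral_iterate_derivative_le D hm.ne_zero (N := n + k) (by lia)
    hd.le hld
  have h2 : ENNReal.ofReal |Real.log ‖(derivative^[l] (polyWithZeros z w)).leadingCoeff‖ -
      Real.log ‖(polyWithZeros z w).leadingCoeff‖| ≤ l * t := by
    refine (ENNReal.ofReal_le_ofReal (abs_log_leadingCoeff_iterate_derivative_le hm hld)).trans ?_
    rw [hd, ENNReal.ofReal_mul (Nat.cast_nonneg l), ENNReal.ofReal_natCast]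
    gcongr
  calc _ ≤ l * (t * volume D + (discInvNormIntegral + volume D) * t) + l * t * volume D := by
        refine add_le_add (h1.trans ?_) (mul_le_mul_left h2 _)
        gcongr
        exact le_mul_of_one_le_right' ht1
    _ = _ := by ring

open Polynomial in
/-- The part of the error bound which comes from `log⁺ |p / p⁽ˡ⁾|`. -/
theorem lintegral_logRatioIntegral_polyWithZeros_le {n k : ℕ} (z : Fin n → ℂ)
    {ν : (Fin k → ℂ) → ℝ≥0∞} (hν : Measurable ν) (hν1 : ∫⁻ w, ν w = 1)
    {C₁ : ℝ≥0∞} {C₂ a : ℝ} (hC₂ : 0 < C₂)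
    (hlog : ∫⁻ w, (∑ i, ENNReal.ofReal (Real.posLog ‖w i‖)) * ν w ≤ C₁)
    (hcond : ∀ (i : Fin k) (w : Fin k → ℂ), (⨆ v : ℂ, ν (Function.update w i v)) ≤
        ENNReal.ofReal (C₂ * Real.exp ((n : ℝ) ^ a)) * ∫⁻ v : ℂ, ν (Function.update w i v))
    (R : ℝ) {l : ℕ} (hl : l ≤ k) :
    ∫⁻ w, logRatioIntegral (Metric.closedBall 0 R) (polyWithZeros z w)
        (derivative^[l] (polyWithZeros z w)) * ν w ≤
      l * (ENNReal.ofReal (4 * Real.log 2 + 3 * Real.posLog R) + 3 * C₁ +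
        (ENNReal.ofReal (Real.posLog C₂) + 1 + discInvNormIntegral)) *
        volume (Metric.closedBall (0 : ℂ) R) * ENNReal.ofReal (logErrorGrowth k a n) := by
  have h := lintegral_logRatioIntegral_le (s := Finset.univ) (monic_prod_X_sub_C z) hν hν1
    (by positivity) hcond hlog R (l := l) (by simpa using hl)
  simp only [← polyWithZeros_eq] at h
  refine h.trans ?_
  set t := ENNReal.ofReal (logErrorGrowth k a n) with ht
  have ht1 : 1 ≤ t := ENNReal.one_le_ofReal.2 (one_le_logErrorGrowth k a n)
  -- Here the sub-exponential density bound turns into an error of order `n ^ a`.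
  have hB : ENNReal.ofReal (Real.posLog (C₂ * Real.exp ((n : ℝ) ^ a))) ≤
      ENNReal.ofReal (Real.posLog C₂) * t + t := by
    have h1 : Real.posLog (Real.exp ((n : ℝ) ^ a)) = (n : ℝ) ^ a := by
      rw [Real.posLog_apply, Real.log_exp, max_eq_right (by positivity)]
    refine (ENNReal.ofReal_le_ofReal Real.posLog_mul).trans ?_
    rw [h1, ENNReal.ofReal_add Real.posLog_nonneg (by positivity)]
    gcongr
    · exact le_mul_of_one_le_right' ht1
    · exact ENNReal.ofReal_le_ofReal (rpow_le_logErrorGrowth k a n)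
  set c := ENNReal.ofReal (4 * Real.log 2 + 3 * Real.posLog R)
  calc _ ≤ l * ((c * t + 3 * C₁ * t + ((ENNReal.ofReal (Real.posLog C₂) * t + t) +
        discInvNormIntegral * t)) * volume (Metric.closedBall (0 : ℂ) R)) := by
        have hmul : ∀ x : ℝ≥0∞, x ≤ x * t := fun x => le_mul_of_one_le_right' ht1
        exact mul_le_mul_right (mul_le_mul_left (add_le_add (add_le_add (hmul _) (hmul _))
          (add_le_add hB (hmul _))) _) _
    _ = _ := by ring

/-! ### Convergence in probability -/

open Polynomial in
theorem tendstoInMeasure_integral_zeroMeasure_iterate_derivative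
    (μ : Measure ℂ) (z : (n : ℕ) → Fin n → ℂ) (hz : IsDistributedArray μ z)
    {Ω : Type*} [MeasurableSpace Ω] (P : Measure Ω) [IsProbabilityMeasure P]
    (k : ℕ) (X : ℕ → Ω → Fin k → ℂ) (ν : ℕ → (Fin k → ℂ) → ℝ≥0∞)
    (hX : ∀ n, 1 ≤ n → Measurable (X n))
    (hν : ∀ n, 1 ≤ n → Measurable (ν n))
    (hlaw : ∀ n, 1 ≤ n → P.map (X n) = (volume : Measure (Fin k → ℂ)).withDensity (ν n))
    (C₁ C₂ a : ℝ) (hC₂ : 0 < C₂) (ha₁ : a < 1)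
    (hlog : ∀ n, 1 ≤ n →
      ∫⁻ w : Fin k → ℂ, (∑ i, ENNReal.ofReal (Real.posLog ‖w i‖)) * ν n w ≤ ENNReal.ofReal C₁)
    (hcond : ∀ n, 1 ≤ n → ∀ (i : Fin k) (w : Fin k → ℂ),
      (⨆ v : ℂ, ν n (Function.update w i v)) ≤
        ENNReal.ofReal (C₂ * Real.exp ((n : ℝ) ^ a)) * ∫⁻ v : ℂ, ν n (Function.update w i v))
    {l : ℕ} (hl : l ≤ k) (f : ℂ →ᵇ ℝ) (hf : HasCompactSupport f) :
    TendstoInMeasure P (fun n ω => ∫ x, f x ∂(zeroMeasure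
      (derivative^[l] (polyWithZeros (z n) (X n ω))))) atTop (fun _ => ∫ x, f x ∂μ) := by
  rw [tendstoInMeasure_iff_dist]
  intro η hη
  -- For `n ≥ k` the two polynomials have at most `4 * n` zeros together, so accuracy `η / 16` per
  -- zero costs at most `η / 4 * n`.
  obtain ⟨G, C, R, hG, hC, hR, hGC, hG0, hGf⟩ := exists_log_kernel f.continuous hf
    (by positivity : 0 < η / 16)
  set D := Metric.closedBall (0 : ℂ) R with hD
  have hGD : ∀ b, |f b - ∫ x in D, G x * Real.log ‖x - b‖| ≤ η / 16 := by
    intro b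
    rw [setIntegral_eq_integral_of_forall_compl_eq_zero]
    · exact hGf b
    · intro x hx
      rw [hD, mem_closedBall_zero_iff, not_le] at hx
      rw [hG0 x hx, zero_mul]
  have hvol : volume D ≠ ⊤ := measure_closedBall_lt_top.ne
  set κ₁ : ℝ≥0∞ := l * (3 * volume D + discInvNormIntegral) with hκ₁
  set κ₂ : ℝ≥0∞ := l * (ENNReal.ofReal (4 * Real.log 2 + 3 * Real.posLog R) +
    3 * ENNReal.ofReal C₁ + (ENNReal.ofReal (Real.posLog C₂) + 1 + discInvNormIntegral)) *
        volume D with hκ₂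
  have hK := discInvNormIntegral_ne_top
  have hκ₁t : κ₁ ≠ ⊤ := by finiteness
  have hκ₂t : κ₂ ≠ ⊤ := by finiteness
  set κ := ENNReal.ofReal C * (κ₁ + κ₂) * ENNReal.ofReal (4 / η) with hκ
  have hκt : κ ≠ ⊤ := by finiteness
  have hlim : Tendsto (fun n : ℕ => κ * ENNReal.ofReal (logErrorGrowth k a n / n)) atTop
      (𝓝 0) := by
    have := ENNReal.Tendsto.const_mul (a := κ)
      (ENNReal.tendsto_ofReal (tendsto_logErrorGrowth_div k ha₁)) (Or.inr hκt)
    simpa using this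
  refine tendsto_of_tendsto_of_tendsto_of_le_of_le' tendsto_const_nhds hlim
    (Eventually.of_forall fun _ => zero_le) ?_
  have hev1 := Metric.tendsto_atTop.1 (hz f) (η / 4) (by positivity)
  obtain ⟨n₁, hn₁⟩ := hev1
  have hev2 : ∀ᶠ n : ℕ in atTop, 2 * k * ‖f‖ / (n : ℝ) < η / 4 :=
    (tendsto_const_div_atTop_nhds_zero_nat _).eventually (gt_mem_nhds (by positivity))
  filter_upwards [eventually_ge_atTop 1, eventually_ge_atTop k, eventually_ge_atTop n₁, hev2]
    with n hn hnk hnn₁ hn2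
  have hn0 : (0 : ℝ) < n := by exact_mod_cast hn
  have hnk' : (k : ℝ) ≤ n := by exact_mod_cast hnk
  set t := ENNReal.ofReal (logErrorGrowth k a n) with ht
  set H : (Fin k → ℂ) → ℝ≥0∞ := fun w => logRatioIntegral D (polyWithZeros (z n) w)
    (derivative^[l] (polyWithZeros (z n) w)) with hH
  have hHm : Measurable H := measurable_logRatioIntegral_polyMulRoots D _ Finset.univ l
  -- Of a deviation `η`, the array and the `k` extra zeros each absorb `η / 4`. The remaining `η / 2
  -- * n` in the linear statistics is reduced by the kernel error to `η / 4 * n`, which the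
  -- logarithmic ratios must account for.
  have hsub : {ω | η ≤ dist (∫ x, f x ∂(zeroMeasure
      (derivative^[l] (polyWithZeros (z n) (X n ω))))) (∫ x, f x ∂μ)} ⊆
      {ω | ENNReal.ofReal (η / 4 * n) ≤ ENNReal.ofReal C * (κ₁ * t + H (X n ω))} := by
    intro ω hω
    rw [Set.mem_ofPred_eq] at hω ⊢
    set w := X n ω
    have e1 := hn₁ n hnn₁
    have e2 := abs_integral_zeroMeasure_sub_le f hn (z n) w hl
    rw [← Real.dist_eq] at e2
    have e3 := dist_triangle (∫ x, f x ∂(zeroMeasure (derivative^[l] (polyWithZeros (z n) w))))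
      (∫ x, f x ∂(empiricalMeasure (Finset.univ.val.map (z n)))) (∫ x, f x ∂μ)
    set S := |((derivative^[l] (polyWithZeros (z n) w)).roots.map f).sum -
        ((polyWithZeros (z n) w).roots.map f).sum| with hS
    have e4 : η / 2 * n ≤ S := by
      rw [mul_add, ← div_eq_inv_mul (2 * k * ‖f‖), ← div_eq_inv_mul] at e2
      have : η / 2 ≤ S / n := by linarith
      rwa [le_div_iff₀ hn0] at this
    have hp0 := (monic_polyWithZeros (z n) w).ne_zero
    have hq0 : derivative^[l] (polyWithZeros (z n) w) ≠ 0 :=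
      iterate_derivative_ne_zero hp0 (by rw [natDegree_polyWithZeros]; lia)
    have e5 := abs_sum_roots_sub_le hG hC hGC hGD hq0 hp0
    rw [← hS] at e5
    have e6 : ((derivative^[l] (polyWithZeros (z n) w)).roots.card +
        (polyWithZeros (z n) w).roots.card : ℝ) * (η / 16) ≤ η / 4 * n := by
      have h1 : ((derivative^[l] (polyWithZeros (z n) w)).roots.card : ℝ) ≤ 2 * n := by
        rw [card_roots_iterate_derivative_polyWithZeros _ _ hl]
        exact_mod_cast (by lia : n + k - l ≤ 2 * n)
      have h2 : ((polyWithZeros (z n) w).roots.card : ℝ) ≤ 2 * n := by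
        rw [card_roots_eq, natDegree_polyWithZeros]
        exact_mod_cast (by lia : n + k ≤ 2 * n)
      nlinarith
    have e7 : ENNReal.ofReal (η / 2 * n) =
        ENNReal.ofReal (η / 4 * n) + ENNReal.ofReal (η / 4 * n) := by
      rw [← ENNReal.ofReal_add (by positivity) (by positivity)]
      ring_nf
    have e8 := logRatioIntegral_add_leadingCoeff_le D hn (z n) w a hl
    have e9 := (ENNReal.ofReal_le_ofReal e4).trans e5
    rw [e7] at e9
    refine (ENNReal.add_le_add_iff_left (ENNReal.ofReal_ne_top (r := η / 4 * n))).1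
      (e9.trans (add_le_add (ENNReal.ofReal_le_ofReal e6) ?_))
    refine mul_le_mul_right ?_ _
    rw [add_right_comm]
    exact add_le_add e8 le_rfl
  have hν1 : ∫⁻ w, ν n w = 1 := by
    have h1 : P.map (X n) Set.univ = 1 := by
      rw [Measure.map_apply (hX n hn) MeasurableSet.univ]
      simp
    rwa [hlaw n hn, withDensity_apply _ MeasurableSet.univ, Measure.restrict_univ] at h1
  have hEH : ∫⁻ ω, H (X n ω) ∂P ≤ κ₂ * t := by
    rw [← lintegral_map hHm (hX n hn), hlaw n hn, lintegral_withDensity_eq_lintegral_mul _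
      (hν n hn) hHm]
    refine le_trans (le_of_eq (lintegral_congr fun w => ?_))
      (lintegral_logRatioIntegral_polyWithZeros_le (z n) (hν n hn) hν1 hC₂ (hlog n hn)
        (hcond n hn) R hl)
    exact mul_comm _ _
  have hHX : Measurable fun ω => H (X n ω) := hHm.comp (hX n hn)
  have hηn : 0 < η / 4 * n := by positivity
  refine (measure_mono hsub).trans ((meas_ge_le_lintegral_div
    (((hHX.const_add (κ₁ * t)).const_mul (ENNReal.ofReal C)).aemeasurable)
    (ENNReal.ofReal_pos.2 hηn).ne' ENNReal.ofReal_ne_top).trans ?_)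
  calc (∫⁻ ω, ENNReal.ofReal C * (κ₁ * t + H (X n ω)) ∂P) / ENNReal.ofReal (η / 4 * n)
      ≤ ENNReal.ofReal C * (κ₁ * t + κ₂ * t) / ENNReal.ofReal (η / 4 * n) := by
        rw [lintegral_const_mul _ (hHX.const_add _), lintegral_add_left measurable_const,
          lintegral_const, measure_univ, mul_one]
        gcongr
    _ = κ * ENNReal.ofReal (logErrorGrowth k a n / n) := by
        have h1 : ENNReal.ofReal (logErrorGrowth k a n / n) = t * ENNReal.ofReal (n : ℝ)⁻¹ := by
          rw [div_eq_mul_inv, ENNReal.ofReal_mul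
            (zero_le_one.trans (one_le_logErrorGrowth k a n))]
        have h2 : (ENNReal.ofReal (η / 4 * n))⁻¹ =
            ENNReal.ofReal (4 / η) * ENNReal.ofReal (n : ℝ)⁻¹ := by
          rw [← ENNReal.ofReal_inv_of_pos hηn, mul_inv, inv_div,
            ENNReal.ofReal_mul (by positivity)]
        rw [h1, div_eq_mul_inv, h2, hκ]
        ring

theorem theorem1p5
    -- the deterministic zeros
    (μ : Measure ℂ) [IsProbabilityMeasure μ]
    (z : (n : ℕ) → Fin n → ℂ) (hz : IsDistributedArray μ z)
    -- the random zeros and their joint densities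
    {Ω : Type*} [MeasurableSpace Ω] (P : Measure Ω) [IsProbabilityMeasure P]
    (k : ℕ) (X : ℕ → Ω → Fin k → ℂ) (ν : ℕ → (Fin k → ℂ) → ℝ≥0∞)
    (hX : ∀ n, 1 ≤ n → Measurable (X n))
    (hν : ∀ n, 1 ≤ n → Measurable (ν n))
    (hlaw : ∀ n, 1 ≤ n → P.map (X n) = (volume : Measure (Fin k → ℂ)).withDensity (ν n))
    (C₁ C₂ a : ℝ) (hC₁ : 0 < C₁) (hC₂ : 0 < C₂) (ha₀ : 0 ≤ a) (ha₁ : a < 1)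
    -- bounded logarithmic moments
    (hlog : ∀ n, 1 ≤ n →
      ∫⁻ w : Fin k → ℂ, (∑ i, ENNReal.ofReal (Real.posLog ‖w i‖)) * ν n w ≤ ENNReal.ofReal C₁)
    -- sub-exponentially bounded conditional densities (the bound on the quotient is multiplied
    -- out, so that `ν n` may vanish identically along a fibre)
    (hcond : ∀ n, 1 ≤ n → ∀ (i : Fin k) (w : Fin k → ℂ),
      (⨆ v : ℂ, ν n (Function.update w i v)) ≤
        ENNReal.ofReal (C₂ * Real.exp ((n : ℝ) ^ a)) * ∫⁻ v : ℂ, ν n (Function.update w i v))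
    -- tightness
    (htight : Tendsto
      (fun r : ℝ => limsup (fun n : ℕ => P {ω | ∃ i, r ≤ ‖X n ω i‖}) atTop) atTop (𝓝 0)) :
    TendstoWeaklyInProbability P
        (fun n ω => zeroMeasure (polyWithZeros (z n) (X n ω))) μ ∧
      ∀ ℓ : ℕ, 1 ≤ ℓ → ℓ ≤ k →
        TendstoWeaklyInProbability P
          (fun n ω => zeroMeasure (Polynomial.derivative^[ℓ] (polyWithZeros (z n) (X n ω)))) μ := by
  have key : ∀ l ≤ k, TendstoWeaklyInProbability P
      (fun n ω => zeroMeasure (Polynomial.derivative^[l] (polyWithZeros (z n) (X n ω)))) μ := by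
    intro l hl
    refine tendstoWeaklyInProbability_of_hasCompactSupport ?_ fun f hf =>
      tendstoInMeasure_integral_zeroMeasure_iterate_derivative μ z hz P k X ν hX hν hlaw C₁ C₂ a
        hC₂ ha₁ hlog hcond hl f hf
    -- For `n = 0` and `l = k` the derivative is constant and its zero measure vanishes, so `n ≥ 1`
    -- is needed.
    filter_upwards [eventually_ge_atTop 1] with n hn ω
    refine isProbabilityMeasure_empiricalMeasure ?_
    rw [card_roots_iterate_derivative_polyWithZeros _ _ hl]
    lia
  -- Order zero is the statement about `P_n` itself.
  exact ⟨key 0 (Nat.zero_le k), fun l _ hl => key l hl⟩
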